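/- Let $m,n\ge 1$, $S_1=\{1,\dots,m\}$, $S_2=\{1,\dots,n\}$, $A,C\in\mathbb R^{m\times n}$, $\beta\in\mathbb R^n$, and for $\alpha\in\mathbb R^m$ let $G(\alpha)$ be the bimatrix game $(A,\,C+\alpha\beta^T)$ (the first player chooses a row). For payoff matrices $A,B$ put $$P=\{(y,\pi_1)\in\mathbb R^{n+1} : A_iy\le\pi_1\ (i\in S_1),\ y_j\ge 0\ (j\in S_2),\ \textstyle\sum_j y_j=1\},$$ $$Q=\{(x,\pi_2)\in\mathbb R^{m+1} : x_i\ge 0\ (i\in S_1),\ x^TB^j\le\pi_2\ (j\in S_2),\ \textstyle\sum_i x_i=1\},$$ $$Q'=\{(x,\lambda,\pi_2)\in\mathbb R^{m+2} : x_i\ge 0\ (i\in S_1),\ x^TC^j+\beta_j\lambda\le\pi_2\ (j\in S_2),\ \textstyle\sum_i x_i=1\},$$ where $A_i$ is the $i$-th row of $A$ and $B^j$, $C^j$ are the $j$-th columns of $B$, $C$. The inequalities of each polyhedron are labelled by $S_1\sqcup S_2$, and $L(\cdot)$ is the set of labels of the inequalities that are tight at a point. The polyhedra $P$, $Q$, $Q'$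 (of dimensions $n$, $m$, $m+1$) are non-degenerate if $|L|\le n$, $|L|\le m$, $|L|\le m+1$, respectively, at all their points; a game $(A,B)$ is non-degenerate if its $P$ and $Q$ are. Let $\mathcal N=\{(v,w)\in P\times Q' : L(v)\cup L(w)=S_1\sqcup S_2\}$. A vertex of $\mathcal N$ is a vertex of $P\times Q'$ in $\mathcal N$, and an edge of $\mathcal N$ is a (possibly unbounded) one-dimensional face of $P\times Q'$ contained in $\mathcal N$. Assume that $P$ and $Q'$ are non-degenerate. At a vertex $u=(v,w)$ of $\mathcal N$, with $v=(y,\pi_1)$ and $w=(x,\lambda,\pi_2)$, there is exactly one label $l\in L(v)\cap L(w)$; let $X=L(v)\cap S_1$ and $Y=L(w)\cap S_2$. Let $E(v)$ be the matrix whose rows are the coefficient vectors of $\sum_j y_j$, of $A_iy-\pi_1$ $(i\in X)$, of $-y_l$ (only if $l\in Y$), and of $-y_j$ $(j\in S_2\setminus Y)$, in this order, with respect to the variables $y_Y,\,y_{S_2\setminus Y},\,\pi_1$ in this order. Let $E(w)$ be the matrix whose columns are the coefficient vectors of $\sum_i x_i$, of $x^TC^j+\beta_j\lambda-\pi_2$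 $(j\in Y)$, of $-x_l$ (only if $l\in X$), and of $-x_i$ $(i\in S_1\setminus X)$, in this order, with respect to the variables $\lambda,\,x_X,\,x_{S_1\setminus X},\,\pi_2$ in this order. Put $E(u)=\begin{pmatrix}E(v)&0\\0&E(w)^T\end{pmatrix}$ and $s(u)=\operatorname{sign}\det E(u)=\operatorname{sign}(\det E(v)\det E(w))$. Orient the edges of $\mathcal N$ that have a vertex as follows: if $s(u)=+1$, the edge at $u$ on which $w$ is constant is directed away from $u$ and the edge at $u$ on which $v$ is constant is directed towards $u$; if $s(u)=-1$, the other way round. For a non-degenerate game $(A,B)$ with all entries of $A$ and $B$ positive, the index of a Nash equilibrium $(x,y)$ with supports $I=\{i : x_i>0\}$, $J=\{j : y_j>0\}$ is $(-1)^{|I|+1}\operatorname{sign}(\det A_I^J\cdot\det B_I^J)$, where $A_I^J$, $B_I^J$ are the submatrices with rows $I$ and columns $J$. (1) Suppose that $G(\alpha)$ is non-degenerate and that all entries of $A$ and of $C+\alpha\beta^T$ are positive. Let $H$, $H^-$, $H^+$ be the sets where $\lambda-\sum_i\alpha_ix_i$ is zero, negative, positive, respectively. If an edge of $\mathcal N$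 (a segment or a ray, with at least one vertex) meets $H$ at a point $((y,\pi_1),(x,\lambda,\pi_2))$, then $(x,y)$ is a Nash equilibrium of $G(\alpha)$; its index is $+1$ if the edge, with its orientation, goes from $H^-$ to $H^+$, and $-1$ otherwise. (2) (Index theorem.) Every non-degenerate bimatrix game $(A,B)$ of size $m\times n$ with positive payoff matrices has finitely many Nash equilibria, each has index $+1$ or $-1$, and there is exactly one more equilibrium of index $+1$ than of index $-1$. -/

import Mathlib

open scoped Matrix

namespace BimatrixGame

noncomputable section

/-- The determinant of the matrix `(M r c)` whose rows are listed, in this order, by `R` and whose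
columns are listed, in this order, by `K` (only meant for lists of the same length). -/
def listDet {ρ κ : Type*} (R : List ρ) (K : List κ) (M : ρ → κ → ℝ) : ℝ :=
  if h : R.length = K.length then
    Matrix.det (Matrix.of fun i j : Fin R.length => M (R.get i) (K.get (j.cast h)))
  else 0

/-- The elements of a subset of `Fin k`, in increasing order. -/
def listed {k : ℕ} (S : Finset (Fin k)) : List (Fin k) :=
  (List.finRange k).filter (· ∈ S)

variable {m n : ℕ}

/-! ### Games, Nash equilibria, the index -/

/-- `(x, y)` is a Nash equilibrium (in mixed strategies) of the bimatrix game `(A, B)`. -/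
def IsNash (A B : Matrix (Fin m) (Fin n) ℝ) (x : Fin m → ℝ) (y : Fin n → ℝ) : Prop :=
  x ∈ stdSimplex ℝ (Fin m) ∧ y ∈ stdSimplex ℝ (Fin n) ∧
  (∀ x' ∈ stdSimplex ℝ (Fin m), x' ⬝ᵥ (A *ᵥ y) ≤ x ⬝ᵥ (A *ᵥ y)) ∧
  (∀ y' ∈ stdSimplex ℝ (Fin n), x ⬝ᵥ (B *ᵥ y') ≤ x ⬝ᵥ (B *ᵥ y))

open Classical in
/-- The set of pure strategies that are played with positive probability. -/
def supp {k : ℕ} (x : Fin k → ℝ) : Finset (Fin k) := Finset.univ.filter fun i => 0 < x i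

/-- The Shapley index `(-1)^(|I|+1) sign (det A_I^J * det B_I^J)`, where `I` and `J` are the supports
of `x` and `y`. -/
def index (A B : Matrix (Fin m) (Fin n) ℝ) (x : Fin m → ℝ) (y : Fin n → ℝ) : ℤ :=
  (-1) ^ ((supp x).card + 1) *
    ((SignType.sign
      (listDet (listed (supp x)) (listed (supp y)) A *
        listDet (listed (supp x)) (listed (supp y)) B) : SignType) : ℤ)

/-! ### The best response polyhedra and their labels

Labels are elements of `Fin m ⊕ Fin n`. A point of `P` is `(y, π₁)`, a point of `Q` is `(x, π₂)`
and a point of `Q'` is `(x, λ, π₂)`. -/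

/-- The best response polyhedron of the row player. -/
def P (A : Matrix (Fin m) (Fin n) ℝ) : Set ((Fin n → ℝ) × ℝ) :=
  {v | (∀ i, (A *ᵥ v.1) i ≤ v.2) ∧ (∀ j, 0 ≤ v.1 j) ∧ ∑ j, v.1 j = 1}

/-- The best response polyhedron of the column player. -/
def Q (B : Matrix (Fin m) (Fin n) ℝ) : Set ((Fin m → ℝ) × ℝ) :=
  {w | (∀ i, 0 ≤ w.1 i) ∧ (∀ j, (w.1 ᵥ* B) j ≤ w.2) ∧ ∑ i, w.1 i = 1}

/-- The polyhedron `Q'` of the family of games `(A, C + α βᵀ)`, with the extra variable `λ`. -/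
def Q' (C : Matrix (Fin m) (Fin n) ℝ) (β : Fin n → ℝ) : Set ((Fin m → ℝ) × ℝ × ℝ) :=
  {w | (∀ i, 0 ≤ w.1 i) ∧ (∀ j, (w.1 ᵥ* C) j + β j * w.2.1 ≤ w.2.2) ∧ ∑ i, w.1 i = 1}

open Classical in
/-- Tight inequalities of `P` at `v`. -/
def labelP (A : Matrix (Fin m) (Fin n) ℝ) (v : (Fin n → ℝ) × ℝ) : Finset (Fin m ⊕ Fin n) :=
  Finset.univ.filter (Sum.elim (fun i => (A *ᵥ v.1) i = v.2) (fun j => v.1 j = 0))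

open Classical in
/-- Tight inequalities of `Q` at `w`. -/
def labelQ (B : Matrix (Fin m) (Fin n) ℝ) (w : (Fin m → ℝ) × ℝ) : Finset (Fin m ⊕ Fin n) :=
  Finset.univ.filter (Sum.elim (fun i => w.1 i = 0) (fun j => (w.1 ᵥ* B) j = w.2))

open Classical in
/-- Tight inequalities of `Q'` at `w`. -/
def labelQ' (C : Matrix (Fin m) (Fin n) ℝ) (β : Fin n → ℝ) (w : (Fin m → ℝ) × ℝ × ℝ) :
    Finset (Fin m ⊕ Fin n) :=
  Finset.univ.filter
    (Sum.elim (fun i => w.1 i = 0) (fun j => (w.1 ᵥ* C) j + β j * w.2.1 = w.2.2))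

/-- `P` (a polyhedron of dimension `n`) is non-degenerate: no point has more than `n` tight
inequalities. -/
def NondegP (A : Matrix (Fin m) (Fin n) ℝ) : Prop := ∀ v ∈ P A, (labelP A v).card ≤ n

/-- `Q` (a polyhedron of dimension `m`) is non-degenerate. -/
def NondegQ (B : Matrix (Fin m) (Fin n) ℝ) : Prop := ∀ w ∈ Q B, (labelQ B w).card ≤ m

/-- `Q'` (a polyhedron of dimension `m + 1`) is non-degenerate. -/
def NondegQ' (C : Matrix (Fin m) (Fin n) ℝ) (β : Fin n → ℝ) : Prop :=
  ∀ w ∈ Q' C β, (labelQ' C β w).card ≤ m + 1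

/-- A bimatrix game is non-degenerate if both best response polyhedra are. -/
def Nondegenerate (A B : Matrix (Fin m) (Fin n) ℝ) : Prop := NondegP A ∧ NondegQ B

/-! ### The fully labeled pairs of `P × Q'` and the edges they form -/

/-- The space of pairs `((y, π₁), (x, λ, π₂))`. -/
abbrev Pt (m n : ℕ) : Type := ((Fin n → ℝ) × ℝ) × ((Fin m → ℝ) × ℝ × ℝ)

/-- The set `N` of fully labeled pairs in `P × Q'`. -/
def N (A C : Matrix (Fin m) (Fin n) ℝ) (β : Fin n → ℝ) : Set (Pt m n) :=
  {u | u ∈ P A ×ˢ Q' C β ∧ labelP A u.1 ∪ labelQ' C β u.2 = Finset.univ}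

/-- `u` is a vertex of `N`: a vertex of `P × Q'` that is fully labeled. -/
def IsVertexN (A C : Matrix (Fin m) (Fin n) ℝ) (β : Fin n → ℝ) (u : Pt m n) : Prop :=
  u ∈ N A C β ∧ u ∈ Set.extremePoints ℝ (P A ×ˢ Q' C β)

/-- `F` is an edge of `N`: a (possibly unbounded) one-dimensional face of `P × Q'` that consists of
fully labeled pairs. -/
def IsEdgeN (A C : Matrix (Fin m) (Fin n) ℝ) (β : Fin n → ℝ) (F : Set (Pt m n)) : Prop :=
  F ⊆ N A C β ∧ IsExposed ℝ (P A ×ˢ Q' C β) F ∧ Module.finrank ℝ (vectorSpan ℝ F) = 1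

/-! ### The sign of a vertex of `N`

The constraints at `v ∈ P` and at `w ∈ Q'` are indexed by `Option (Fin m ⊕ Fin n)`: `none` is the
equation `∑ y = 1` (resp. `∑ x = 1`) and `some k` is the inequality with label `k`. The variables of
`P` are indexed by `Option (Fin n)`, with `some j` for `y_j` and `none` for `π₁`. -/

/-- Coefficients of the constraints of `P`. -/
def coeffP (A : Matrix (Fin m) (Fin n) ℝ) : Option (Fin m ⊕ Fin n) → Option (Fin n) → ℝ
  | none, some _ => 1
  | none, none => 0
  | some (Sum.inl i), some j => A i j
  | some (Sum.inl _), none => -1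
  | some (Sum.inr j), some j' => if j = j' then -1 else 0
  | some (Sum.inr _), none => 0

/-- The variables `λ`, `x_i`, `π₂` of `Q'`. -/
inductive VarQ' (m : ℕ) : Type
  | lam : VarQ' m
  | x (i : Fin m) : VarQ' m
  | pi : VarQ' m

/-- Coefficients of the constraints of `Q'`; the rows are the variables and the columns the
constraints. -/
def coeffQ' (C : Matrix (Fin m) (Fin n) ℝ) (β : Fin n → ℝ) :
    VarQ' m → Option (Fin m ⊕ Fin n) → ℝ
  | VarQ'.lam, none => 0
  | VarQ'.x _, none => 1
  | VarQ'.pi, none => 0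
  | VarQ'.lam, some (Sum.inr j) => β j
  | VarQ'.x i, some (Sum.inr j) => C i j
  | VarQ'.pi, some (Sum.inr _) => -1
  | VarQ'.lam, some (Sum.inl _) => 0
  | VarQ'.x i, some (Sum.inl i') => if i = i' then -1 else 0
  | VarQ'.pi, some (Sum.inl _) => 0

/-- `X = L(v) ∩ S₁` for `u = (v, w)`: the row strategies `i` with `A_i y = π₁`. -/
def setX (A : Matrix (Fin m) (Fin n) ℝ) (u : Pt m n) : Finset (Fin m) :=
  Finset.univ.filter fun i => Sum.inl i ∈ labelP A u.1

/-- `Y = L(w) ∩ S₂` for `u = (v, w)`: the column strategies `j` with `xᵀ C^j + β_j λ = π₂`. -/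
def setY (C : Matrix (Fin m) (Fin n) ℝ) (β : Fin n → ℝ) (u : Pt m n) : Finset (Fin n) :=
  Finset.univ.filter fun j => Sum.inr j ∈ labelQ' C β u.2

/-- The duplicate label, if it is a row strategy. At a vertex of `N` exactly one of `dupX`, `dupY`
is non-empty, and it is a singleton. -/
def dupX (A C : Matrix (Fin m) (Fin n) ℝ) (β : Fin n → ℝ) (u : Pt m n) : Finset (Fin m) :=
  Finset.univ.filter fun i => Sum.inl i ∈ labelP A u.1 ∩ labelQ' C β u.2

/-- The duplicate label, if it is a column strategy. -/
def dupY (A C : Matrix (Fin m) (Fin n) ℝ) (β : Fin n → ℝ) (u : Pt m n) : Finset (Fin n) :=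
  Finset.univ.filter fun j => Sum.inr j ∈ labelP A u.1 ∩ labelQ' C β u.2

/-- `det E(v)`. Rows: `∑ y = 1`; `A_i y - π₁` for `i ∈ X`; `-y_l` if the duplicate label `l` lies in
`Y`; `-y_j` for `j ∉ Y`. Columns: `y_Y`, `y_{-Y}`, `π₁`. -/
def detEv (A C : Matrix (Fin m) (Fin n) ℝ) (β : Fin n → ℝ) (u : Pt m n) : ℝ :=
  listDet
    (none :: ((listed (setX A u)).map (fun i => some (Sum.inl i))
      ++ (listed (dupY A C β u)).map (fun j => some (Sum.inr j))
      ++ (listed (setY C β u)ᶜ).map (fun j => some (Sum.inr j))))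
    ((listed (setY C β u)).map some ++ (listed (setY C β u)ᶜ).map some ++ [none])
    (coeffP A)

/-- `det E(w)`. Rows: `λ`, `x_X`, `x_{-X}`, `π₂`. Columns: `∑ x = 1`; `xᵀ C^j + β_j λ - π₂` for
`j ∈ Y`; `-x_l` if the duplicate label `l` lies in `X`; `-x_i` for `i ∉ X`. -/
def detEw (A C : Matrix (Fin m) (Fin n) ℝ) (β : Fin n → ℝ) (u : Pt m n) : ℝ :=
  listDet
    (VarQ'.lam :: ((listed (setX A u)).map VarQ'.x ++ (listed (setX A u)ᶜ).map VarQ'.x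
      ++ [VarQ'.pi]))
    (none :: ((listed (setY C β u)).map (fun j => some (Sum.inr j))
      ++ (listed (dupX A C β u)).map (fun i => some (Sum.inl i))
      ++ (listed (setX A u)ᶜ).map (fun i => some (Sum.inl i))))
    (coeffQ' C β)

/-- The sign `s(u) = sign det E(u)` with `det E(u) = det E(v) * det E(w)`. -/
def vertexSign (A C : Matrix (Fin m) (Fin n) ℝ) (β : Fin n → ℝ) (u : Pt m n) : SignType :=
  SignType.sign (detEv A C β u * detEw A C β u)

/-! ### The orientation of the edges of `N` -/

/-- The edge `F` is directed away from its vertex `u = (v, w)`: either `F` is of type `(E_w, w)` and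
`s(u) = 1`, or `F` is of type `(v, E_v)` and `s(u) = -1`. -/
def AwayFrom (A C : Matrix (Fin m) (Fin n) ℝ) (β : Fin n → ℝ) (F : Set (Pt m n)) (u : Pt m n) :
    Prop :=
  ((∀ p ∈ F, p.2 = u.2) ∧ vertexSign A C β u = 1) ∨
    ((∀ p ∈ F, p.1 = u.1) ∧ vertexSign A C β u = -1)

/-- The edge `F` is directed towards its vertex `u = (v, w)`: either `F` is of type `(E_w, w)` and
`s(u) = -1`, or `F` is of type `(v, E_v)` and `s(u) = 1`. -/
def Towards (A C : Matrix (Fin m) (Fin n) ℝ) (β : Fin n → ℝ) (F : Set (Pt m n)) (u : Pt m n) :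
    Prop :=
  ((∀ p ∈ F, p.2 = u.2) ∧ vertexSign A C β u = -1) ∨
    ((∀ p ∈ F, p.1 = u.1) ∧ vertexSign A C β u = 1)

/-- The orientation of the edge `F` leads from its point `p` to its point `q`: for an end point `u`
of `F`, either `F` is directed away from `u` and `q` is farther from `u` than `p`, or `F` is directed
towards `u` and `q` is closer to `u` than `p`. (Stated with points of the edge rather than with its
two end points, since the extreme edges of the path in `N` are rays.) -/
def Arrow (A C : Matrix (Fin m) (Fin n) ℝ) (β : Fin n → ℝ) (F : Set (Pt m n)) (p q : Pt m n) :
    Prop :=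
  p ∈ F ∧ q ∈ F ∧ p ≠ q ∧ ∃ u ∈ F, IsVertexN A C β u ∧
    ((AwayFrom A C β F u ∧ p ∈ segment ℝ u q) ∨ (Towards A C β F u ∧ q ∈ segment ℝ u p))

/-- The affine form `λ - ∑ α_i x_i` defining the hyperplane `H` (`= 0`) and its sides `H⁻` (`< 0`)
and `H⁺` (`> 0`). -/
def hyper (α : Fin m → ℝ) (p : Pt m n) : ℝ := p.2.2.1 - ∑ i, α i * p.2.1 i

/-- The edge `F`, with its orientation, goes from `H⁻` to `H⁺`. -/
def CrossesUp (A C : Matrix (Fin m) (Fin n) ℝ) (β : Fin n → ℝ) (α : Fin m → ℝ)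
    (F : Set (Pt m n)) : Prop :=
  ∃ p q, Arrow A C β F p q ∧ hyper α p < 0 ∧ 0 < hyper α q

end

end BimatrixGame

/-! The index theorem is proved by counting cones, not by following paths. Let F have the blocks (0,
B; Aᵀ, 0). After rescaling its two halves, a nonzero complementary solution of zF + w = 1, z, w ≥ 0,
is a Nash equilibrium. So equilibria correspond to the nonempty sets S = I ⊔ J for which q = (1, …,
1) lies in the open cone of the rows of `mixRows 1 F S` (rows of F in S, unit rows elsewhere). The
determinant of this matrix is (-1)^|I| det A_I^J det B_I^J (`det_mixRows_disjSum`), so its sign is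
minus the index, while |S| = 2|I| is even. The empty S gives the positive orthant and contributes
+1. Hence the theorem says that the signed cone indicators, weighted by (-1)^|S|, add up to zero
(`sum_coneSign_mixRows`).

To see this, take a generic vector p. The signed indicator of a cone is the sum of those obtained by
replacing one generator by p (`coneSign_eq_sum`): the nonnegative solutions of b p + aC = q form a
segment of a line, whose two ends carry opposite signs. Once row i has been replaced by p, the sets
S and S Δ {i} give the same cone with opposite weights.

For the crossing statement, let r be the point of the edge on H. Non-degeneracy of G(α) makes the
two label sets of r disjoint, so every point of the edge keeps the labels of r. An equilibrium is
determined by its supports, hence v is constant on the edge (`fst_eq_of_mem_edge`). An end u of the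
edge has exactly one further label k in Q'. Cramer's rule at u, and then at r, shows that up to
positive factors det E(u) times the value of λ - ∑ α_i x_i at u is a negative number times (-1)^|I|
det A_I^J det B_I^J (`det_vertex_mul_hyper`). So the index is s(u) times the sign of that value
(`index_eq_vertexSign_mul_sign`). As v is constant, the edge is directed towards u exactly if s(u) =
1, and the product is +1 exactly for a passage from H⁻ to H⁺. -/

namespace BimatrixGame

/-! ### Determinants with rows and columns listed in a prescribed order -/

section listDet

variable {ρ κ ρ' κ' : Type*}

theorem listDet_ofFn {N : ℕ} (r : Fin N → ρ) (k : Fin N → κ) (M : ρ → κ → ℝ) :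
    listDet (List.ofFn r) (List.ofFn k) M = Matrix.det (Matrix.of fun i j => M (r i) (k j)) := by
  rw [listDet, dif_pos (by simp)]
  rw [← Matrix.det_submatrix_equiv_self (finCongr (List.length_ofFn (f := r)))]
  congr 1
  ext i j
  simp
  rfl

theorem listDet_of_length_ne {R : List ρ} {K : List κ} (h : R.length ≠ K.length)
    (M : ρ → κ → ℝ) : listDet R K M = 0 := dif_neg h

theorem exists_ofFn_of_length_eq {R : List ρ} {K : List κ} (h : R.length = K.length) :
    ∃ (N : ℕ) (r : Fin N → ρ) (k : Fin N → κ), R = List.ofFn r ∧ K = List.ofFn k :=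
  ⟨R.length, R.get, fun i => K.get (i.cast h), by simp, by
    apply List.ext_getElem <;> simp [h]⟩

theorem listDet_transpose (R : List ρ) (K : List κ) (M : ρ → κ → ℝ) :
    listDet K R (fun c r => M r c) = listDet R K M := by
  by_cases h : R.length = K.length
  · obtain ⟨N, r, k, rfl, rfl⟩ := exists_ofFn_of_length_eq h
    rw [listDet_ofFn, listDet_ofFn, ← Matrix.det_transpose]
    rfl
  · rw [listDet_of_length_ne h, listDet_of_length_ne (Ne.symm h)]

theorem listDet_map (R : List ρ) (K : List κ) (f : ρ → ρ') (g : κ → κ') (M : ρ' → κ' → ℝ) :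
    listDet (R.map f) (K.map g) M = listDet R K (fun r c => M (f r) (g c)) := by
  by_cases h : R.length = K.length
  · obtain ⟨N, r, k, rfl, rfl⟩ := exists_ofFn_of_length_eq h
    rw [List.map_ofFn, List.map_ofFn, listDet_ofFn, listDet_ofFn]
    rfl
  · rw [listDet_of_length_ne h, listDet_of_length_ne (by simpa using h)]

theorem listDet_congr {R : List ρ} {K : List κ} {M M' : ρ → κ → ℝ}
    (h : ∀ r ∈ R, ∀ c ∈ K, M r c = M' r c) : listDet R K M = listDet R K M' := by
  by_cases hl : R.length = K.length
  · obtain ⟨N, r, k, rfl, rfl⟩ := exists_ofFn_of_length_eq hl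
    rw [listDet_ofFn, listDet_ofFn]
    congr 1
    ext i j
    exact h _ (by simp) _ (by simp)
  · rw [listDet_of_length_ne hl, listDet_of_length_ne hl]

theorem listDet_swap (L : List ρ) (a b : ρ) (R : List ρ) (K : List κ) (M : ρ → κ → ℝ) :
    listDet (L ++ a :: b :: R) K M = -listDet (L ++ b :: a :: R) K M := by
  by_cases h : (L ++ b :: a :: R).length = K.length
  · obtain ⟨N, r, k, hr, rfl⟩ := exists_ofFn_of_length_eq h
    have hN : L.length + R.length + 2 = N := by
      have := congrArg List.length hr
      simp at this; omega
    have hr' : L ++ a :: b :: R =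
        List.ofFn (r ∘ Equiv.swap (⟨L.length, by omega⟩ : Fin N) ⟨L.length + 1, by omega⟩) := by
      have hg : ∀ i : Fin N, r i = (L ++ b :: a :: R)[i.1]'(by simp; omega) := by
        intro i; simp [hr]
      apply List.ext_getElem
      · simp; omega
      · intro i h1 h2
        simp only [List.getElem_ofFn, Function.comp, hg, Equiv.swap_apply_def, Fin.ext_iff]
        grind
    rw [hr, hr', listDet_ofFn, listDet_ofFn]
    have := Matrix.det_permute (Equiv.swap (⟨L.length, by omega⟩ : Fin N) ⟨L.length + 1, by omega⟩)
      (Matrix.of fun i j => M (r i) (k j))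
    rw [Equiv.Perm.sign_swap (by simp)] at this
    simpa [Matrix.submatrix] using this
  · rw [listDet_of_length_ne h, listDet_of_length_ne (by simpa using h), neg_zero]

/-- The prefix `L` serves the induction: each entry that `r` has to pass is absorbed into it, and
one adjacent swap remains. -/
theorem listDet_move_append (L R₁ : List ρ) (r : ρ) (R₂ : List ρ) (K : List κ) (M : ρ → κ → ℝ) :
    listDet (L ++ (R₁ ++ r :: R₂)) K M =
      (-1) ^ R₁.length * listDet (L ++ r :: (R₁ ++ R₂)) K M := by
  induction R₁ generalizing L with
  | nil => simp
  | cons a R₁ ih =>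
    have := ih (L ++ [a])
    simp only [List.append_assoc, List.cons_append, List.nil_append] at this ⊢
    rw [this, listDet_swap, List.length_cons, pow_succ]
    ring

theorem listDet_move (R₁ : List ρ) (r : ρ) (R₂ : List ρ) (K : List κ) (M : ρ → κ → ℝ) :
    listDet (R₁ ++ r :: R₂) K M = (-1) ^ R₁.length * listDet (r :: (R₁ ++ R₂)) K M :=
  listDet_move_append [] R₁ r R₂ K M

theorem listDet_move_col (R : List ρ) (K₁ : List κ) (c : κ) (K₂ : List κ) (M : ρ → κ → ℝ) :
    listDet R (K₁ ++ c :: K₂) M = (-1) ^ K₁.length * listDet R (c :: (K₁ ++ K₂)) M := by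
  rw [← listDet_transpose, listDet_move, listDet_transpose]

theorem listDet_append_comm (L R₁ R₂ : List ρ) (K : List κ) (M : ρ → κ → ℝ) :
    listDet (L ++ (R₁ ++ R₂)) K M =
      (-1) ^ (R₁.length * R₂.length) * listDet (L ++ (R₂ ++ R₁)) K M := by
  induction R₂ generalizing L with
  | nil => simp
  | cons a R₂ ih =>
    rw [listDet_move_append]
    have := ih (L ++ [a])
    simp only [List.append_assoc, List.cons_append, List.nil_append] at this ⊢
    rw [this, List.length_cons, mul_add, mul_one, pow_add]
    ring

theorem det_row_zero {N : ℕ} (A : Matrix (Fin (N + 1)) (Fin (N + 1)) ℝ)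
    (h : ∀ j : Fin N, A 0 j.succ = 0) :
    A.det = A 0 0 * (A.submatrix Fin.succ Fin.succ).det := by
  rw [Matrix.det_succ_row_zero, Fin.sum_univ_succ]
  simp [h]

/-- A linear combination of the rows that vanishes on all columns but the first. -/
theorem listDet_cramer (z : ρ → ℝ) (r : ρ) (R : List ρ) (c : κ) (K : List κ) (M : ρ → κ → ℝ)
    (h : ∀ k ∈ K, z r * M r k + (R.map fun r' => z r' * M r' k).sum = 0) :
    z r * listDet (r :: R) (c :: K) M =
      (z r * M r c + (R.map fun r' => z r' * M r' c).sum) * listDet R K M := by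
  by_cases hl : R.length = K.length
  · obtain ⟨N, rr, k, rfl, rfl⟩ := exists_ofFn_of_length_eq hl
    have e1 : r :: List.ofFn rr = List.ofFn (Fin.cons r rr : Fin (N + 1) → ρ) := by
      simp [List.ofFn_succ]
    have e2 : c :: List.ofFn k = List.ofFn (Fin.cons c k : Fin (N + 1) → κ) := by
      simp [List.ofFn_succ]
    rw [e1, e2, listDet_ofFn, listDet_ofFn]
    set A : Matrix (Fin (N + 1)) (Fin (N + 1)) ℝ :=
      Matrix.of fun i j => M ((Fin.cons r rr : Fin (N + 1) → ρ) i)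
        ((Fin.cons c k : Fin (N + 1) → κ) j) with hA
    -- Replacing row 0 by the combination multiplies the determinant by its own coefficient `z r`;
    -- the new row has a single entry, in column 0.
    have key := Matrix.det_updateRow_sum A 0 (fun i => z ((Fin.cons r rr : Fin (N + 1) → ρ) i))
    rw [det_row_zero] at key
    · simp only [smul_eq_mul, Fin.cons_zero] at key
      rw [← key]
      congr 1
      · simp [Matrix.updateRow_self, Fin.sum_univ_succ, hA, List.map_ofFn, List.sum_ofFn]
    · intro j
      have := h (k j) (by simp)
      simpa [Matrix.updateRow_self, Fin.sum_univ_succ, hA, List.map_ofFn, List.sum_ofFn] using this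
  · rw [listDet_of_length_ne hl, listDet_of_length_ne (by simpa using hl)]
    simp

theorem listDet_cons (r : ρ) (R : List ρ) (c : κ) (K : List κ) (M : ρ → κ → ℝ)
    (h : ∀ k ∈ K, M r k = 0) :
    listDet (r :: R) (c :: K) M = M r c * listDet R K M := by
  by_cases hl : R.length = K.length
  · obtain ⟨N, rr, k, rfl, rfl⟩ := exists_ofFn_of_length_eq hl
    have e1 : r :: List.ofFn rr = List.ofFn (Fin.cons r rr : Fin (N + 1) → ρ) := by
      simp [List.ofFn_succ]
    have e2 : c :: List.ofFn k = List.ofFn (Fin.cons c k : Fin (N + 1) → κ) := by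
      simp [List.ofFn_succ]
    rw [e1, e2, listDet_ofFn, listDet_ofFn, det_row_zero]
    · rfl
    · intro j
      simpa using h (k j) (by simp)
  · rw [listDet_of_length_ne hl, listDet_of_length_ne (by simpa using hl)]
    simp

theorem listDet_cramer_col (z : κ → ℝ) (r : ρ) (R : List ρ) (c : κ) (K : List κ) (M : ρ → κ → ℝ)
    (h : ∀ r' ∈ R, z c * M r' c + (K.map fun k => z k * M r' k).sum = 0) :
    z c * listDet (r :: R) (c :: K) M =
      (z c * M r c + (K.map fun k => z k * M r k).sum) * listDet R K M := by
  rw [← listDet_transpose, listDet_cramer z c K r R _ h, listDet_transpose]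

/-- The matrix is block triangular with one block `ε` times the identity. An element of `T` is split
off by moving its row and its column to the front; both moves have the same sign because `R` and `K`
have equal length. -/
theorem listDet_append_diag {σ : Type*} (ε : ℝ) (T : List σ) (hT : T.Nodup) (f : σ → ρ) (g : σ → κ)
    (R : List ρ) (K : List κ) (M : ρ → κ → ℝ)
    (hd : ∀ a ∈ T, M (f a) (g a) = ε)
    (ho : ∀ a ∈ T, ∀ b ∈ T, a ≠ b → M (f a) (g b) = 0)
    (hK : ∀ a ∈ T, ∀ k ∈ K, M (f a) k = 0) :
    listDet (R ++ T.map f) (K ++ T.map g) M = ε ^ T.length * listDet R K M := by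
  by_cases hl : R.length = K.length
  · induction T with
    | nil => simp
    | cons a T ih =>
      rw [List.nodup_cons] at hT
      rw [List.map_cons, List.map_cons, listDet_move, listDet_move_col, listDet_cons,
        hd a (List.mem_cons_self ..),
        ih hT.2 (fun b hb => hd b (List.mem_cons_of_mem _ hb))
          (fun b hb b' hb' => ho b (List.mem_cons_of_mem _ hb) b' (List.mem_cons_of_mem _ hb'))
          (fun b hb => hK b (List.mem_cons_of_mem _ hb)), hl, List.length_cons, pow_succ]
      · have : ((-1 : ℝ) ^ K.length) * (-1) ^ K.length = 1 := by rw [← mul_pow]; simp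
        linear_combination (ε ^ T.length * ε * listDet R K M) * this
      · intro k hk
        rcases List.mem_append.1 hk with hk | hk
        · exact hK a (List.mem_cons_self ..) k hk
        · obtain ⟨b, hb, rfl⟩ := List.mem_map.1 hk
          exact ho a (List.mem_cons_self ..) b (List.mem_cons_of_mem _ hb) (fun h => hT.1 (h ▸ hb))
  · rw [listDet_of_length_ne hl, listDet_of_length_ne (by simpa using hl), mul_zero]

theorem listDet_append_diag_col {σ : Type*} (ε : ℝ) (T : List σ) (hT : T.Nodup) (f : σ → ρ)
    (g : σ → κ) (R : List ρ) (K : List κ) (M : ρ → κ → ℝ)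
    (hd : ∀ a ∈ T, M (f a) (g a) = ε)
    (ho : ∀ a ∈ T, ∀ b ∈ T, a ≠ b → M (f a) (g b) = 0)
    (hR : ∀ a ∈ T, ∀ r ∈ R, M r (g a) = 0) :
    listDet (R ++ T.map f) (K ++ T.map g) M = ε ^ T.length * listDet R K M := by
  rw [← listDet_transpose, listDet_append_diag ε T hT g f K R _ hd
    (fun a ha b hb h => ho b hb a ha h.symm) hR,
    listDet_transpose]

theorem listDet_block {R₁ R₂ : List ρ} {K₁ K₂ : List κ} {M : ρ → κ → ℝ}
    (h₁ : R₁.length = K₁.length) (h : ∀ r ∈ R₁, ∀ k ∈ K₂, M r k = 0) :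
    listDet (R₁ ++ R₂) (K₁ ++ K₂) M = listDet R₁ K₁ M * listDet R₂ K₂ M := by
  by_cases h₂ : R₂.length = K₂.length
  · obtain ⟨N₁, r₁, k₁, rfl, rfl⟩ := exists_ofFn_of_length_eq h₁
    obtain ⟨N₂, r₂, k₂, rfl, rfl⟩ := exists_ofFn_of_length_eq h₂
    rw [← List.ofFn_fin_append, ← List.ofFn_fin_append, listDet_ofFn, listDet_ofFn, listDet_ofFn,
      ← Matrix.det_fromBlocks_zero₁₂ _ (Matrix.of fun i j => M (r₂ i) (k₁ j)),
      ← Matrix.det_submatrix_equiv_self finSumFinEquiv]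
    congr 1
    ext i j
    rcases i with i | i <;> rcases j with j | j <;> simp
    exact h _ (by simp) _ (by simp)
  · rw [listDet_of_length_ne h₂, listDet_of_length_ne (by simp_all), mul_zero]

theorem listDet_row_op {r₀ : ρ} {R : List ρ} {K : List κ} {M M' : ρ → κ → ℝ}
    (a : ρ → ℝ) (h₀ : ∀ k ∈ K, M' r₀ k = M r₀ k)
    (h : ∀ r ∈ R, ∀ k ∈ K, M' r k = M r k + a r * M r₀ k) :
    listDet (r₀ :: R) K M' = listDet (r₀ :: R) K M := by
  by_cases hl : (r₀ :: R).length = K.length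
  · rcases K with _ | ⟨c, K⟩
    · simp at hl
    obtain ⟨N, rr, k, rfl, rfl⟩ := exists_ofFn_of_length_eq (R := R) (K := K) (by simpa using hl)
    have e1 : r₀ :: List.ofFn rr = List.ofFn (Fin.cons r₀ rr : Fin (N + 1) → ρ) := by
      simp [List.ofFn_succ]
    have e2 : c :: List.ofFn k = List.ofFn (Fin.cons c k : Fin (N + 1) → κ) := by
      simp [List.ofFn_succ]
    rw [e1, e2, listDet_ofFn, listDet_ofFn]
    refine Matrix.det_eq_of_forall_row_eq_smul_add_const (Fin.cons 0 (a ∘ rr)) 0 (by simp) ?_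
    intro i j
    have hj : (Fin.cons c k : Fin (N + 1) → κ) j ∈ c :: List.ofFn k := by
      rw [e2]; exact List.mem_ofFn.2 ⟨j, rfl⟩
    refine Fin.cases ?_ (fun i => ?_) i
    · simpa using h₀ _ hj
    · simpa using h (rr i) (by simp) _ hj
  · rw [listDet_of_length_ne hl, listDet_of_length_ne hl]

/-- The same list orders the rows and the columns, so no sign enters. -/
theorem det_eq_listDet {ι : Type*} [Fintype ι] [DecidableEq ι] (l : List ι) (hl : l.Nodup)
    (hm : ∀ i, i ∈ l) (M : ι → ι → ℝ) : (Matrix.of M).det = listDet l l M := by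
  unfold listDet
  rw [dif_pos rfl,
    ← Matrix.det_submatrix_equiv_self (List.Nodup.getEquivOfForallMemList l hl hm)]
  rfl

theorem mem_listed {k : ℕ} {S : Finset (Fin k)} {i : Fin k} : i ∈ listed S ↔ i ∈ S := by
  simp [listed]

theorem nodup_listed {k : ℕ} (S : Finset (Fin k)) : (listed S).Nodup :=
  (List.nodup_finRange k).filter _

theorem listed_toFinset {k : ℕ} (S : Finset (Fin k)) : (listed S).toFinset = S := by
  ext i; simp [mem_listed]

theorem length_listed {k : ℕ} (S : Finset (Fin k)) : (listed S).length = S.card := by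
  conv_rhs => rw [← listed_toFinset S]
  exact (List.toFinset_card_of_nodup (nodup_listed S)).symm

theorem sum_map_listed {k : ℕ} (S : Finset (Fin k)) (f : Fin k → ℝ) :
    ((listed S).map f).sum = ∑ i ∈ S, f i := by
  conv_rhs => rw [← listed_toFinset S]
  exact (List.sum_toFinset f (nodup_listed S)).symm

theorem listed_empty {k : ℕ} : listed (∅ : Finset (Fin k)) = [] := by simp [listed]

theorem listed_singleton {k : ℕ} (i : Fin k) : listed {i} = [i] := by
  apply List.perm_singleton.1
  apply (List.perm_ext_iff_of_nodup (nodup_listed _) (by simp)).2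
  simp [mem_listed]

/-- Records the position of a duplicate column label in `Y`. The sign that depends on it occurs in
both determinants at a vertex and cancels. -/
theorem listed_insert {k : ℕ} {S : Finset (Fin k)} {i : Fin k} (hi : i ∉ S) :
    ∃ L₁ L₂, listed (insert i S) = L₁ ++ i :: L₂ ∧ listed S = L₁ ++ L₂ := by
  obtain ⟨L₁, L₂, h⟩ := List.append_of_mem (List.mem_finRange i)
  have hn := List.nodup_finRange k
  rw [h] at hn
  have hn1 : i ∉ L₁ ∧ i ∉ L₂ := by
    rw [List.nodup_middle, List.nodup_cons] at hn
    simpa using hn.1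
  have hc : ∀ L : List (Fin k), i ∉ L →
      L.filter (· ∈ insert i S) = L.filter (· ∈ S) := by
    intro L hL
    apply List.filter_congr
    intro a ha
    have : a ≠ i := fun e => hL (e ▸ ha)
    simp [this]
  refine ⟨L₁.filter (· ∈ S), L₂.filter (· ∈ S), ?_, ?_⟩
  · rw [listed, h, List.filter_append, List.filter_cons_of_pos (by simp), hc _ hn1.1, hc _ hn1.2]
  · rw [listed, h, List.filter_append, List.filter_cons_of_neg (by simpa using hi)]

end listDet

/-! ### Signed counting of simplicial cones -/

section IndexSum

/-! ### The ends of a segment -/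

section Line

variable {κ : Type*}

/-- The line `a + t d` leaves the positive orthant through the `k`-th coordinate hyperplane. -/
def LineEnd (a d : κ → ℝ) (k : κ) : Prop :=
  ∃ t : ℝ, a k + t * d k = 0 ∧ ∀ i, i ≠ k → 0 < a i + t * d i

theorem LineEnd.neg {a d : κ → ℝ} {k : κ} (h : LineEnd a d k) : LineEnd a (-d) k := by
  obtain ⟨t, h1, h2⟩ := h
  exact ⟨-t, by simpa using h1, by simpa using h2⟩

theorem lineEnd_unique {a d : κ → ℝ} {k k' : κ} (hk : LineEnd a d k) (hk' : LineEnd a d k')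
    (hd : 0 < d k) (hd' : 0 < d k') : k = k' := by
  obtain ⟨t, h1, h2⟩ := hk
  obtain ⟨t', h1', h2'⟩ := hk'
  by_contra hne
  have e1 := h2 k' (Ne.symm hne)
  have e2 := h2' k hne
  rcases le_total t t' with h | h <;> nlinarith

/-- The ratio test of the simplex method: starting from the given end, increase `t` until the first
coordinate with negative slope vanishes. By `hgen` no other coordinate vanishes there. -/
theorem exists_lineEnd_neg [Fintype κ] {a d : κ → ℝ}
    (hgen : ∀ t, (∀ i, 0 ≤ a i + t * d i) → ∀ k k', a k + t * d k = 0 → a k' + t * d k' = 0 → k = k')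
    (hneg : ∃ k, d k < 0) {k : κ} (hk : LineEnd a d k) (hd : 0 < d k) :
    ∃ k', d k' < 0 ∧ LineEnd a d k' := by
  classical
  obtain ⟨t, h1, h2⟩ := hk
  obtain ⟨k₀, hk₀⟩ := hneg
  obtain ⟨k', hk', hmin⟩ := Finset.exists_min_image (Finset.univ.filter fun k => d k < 0)
    (fun j => a j / (-d j)) ⟨k₀, by simpa using hk₀⟩
  simp only [Finset.mem_filter, Finset.mem_univ, true_and] at hk' hmin
  have hz : a k' + a k' / (-d k') * d k' = 0 := by
    have := hk'.ne
    field_simp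
    ring
  have ht : t ≤ a k' / (-d k') := by
    rw [le_div_iff₀ (by linarith)]
    have := h2 k' (fun e => by rw [e] at hk'; linarith)
    linarith
  have hnn : ∀ i, 0 ≤ a i + a k' / (-d k') * d i := by
    intro i
    rcases lt_or_ge (d i) 0 with hi | hi
    · have := hmin i hi
      rw [le_div_iff₀ (by linarith)] at this
      linarith
    · have h3 : 0 ≤ a i + t * d i := by
        by_cases e : i = k
        · rw [e, h1]
        · exact (h2 i e).le
      nlinarith
  refine ⟨k', hk', a k' / (-d k'), hz, fun i hi => lt_of_le_of_ne (hnn i) ?_⟩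
  intro h0
  exact hi (hgen _ hnn i k' h0.symm hz)

open Classical in
-- A line meets the positive orthant in nothing or in a segment that enters through a coordinate
-- with `d > 0` and leaves through one with `d < 0`. Coordinates with `d = 0` contribute sign 0.
theorem sum_sign_lineEnd [Fintype κ] {a d : κ → ℝ}
    (hgen : ∀ t, (∀ i, 0 ≤ a i + t * d i) → ∀ k k', a k + t * d k = 0 → a k' + t * d k' = 0 → k = k')
    (hneg : ∃ k, d k < 0) (hpos : ∃ k, 0 < d k) :
    ∑ k, (if LineEnd a d k then ((SignType.sign (d k) : SignType) : ℤ) else 0) = 0 := by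
  have hgen' : ∀ t, (∀ i, 0 ≤ a i + t * (-d) i) → ∀ k k', a k + t * (-d) k = 0 →
      a k' + t * (-d) k' = 0 → k = k' := fun t h k k' => by
    simpa using hgen (-t) (by simpa using h) k k'
  by_cases hex : ∃ k, 0 < d k ∧ LineEnd a d k
  · obtain ⟨k, hk, hkL⟩ := hex
    obtain ⟨k', hk', hkL'⟩ := exists_lineEnd_neg hgen hneg hkL hk
    have hne : k ≠ k' := fun e => by rw [e] at hk; linarith
    rw [← Finset.sum_subset (Finset.subset_univ {k, k'}), Finset.sum_pair hne, if_pos hkL,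
      if_pos hkL', sign_pos hk, sign_neg hk']
    · simp
    · intro i _ hi
      simp only [Finset.mem_insert, Finset.mem_singleton, not_or] at hi
      by_cases hiL : LineEnd a d i
      · rw [if_pos hiL]
        rcases lt_trichotomy (d i) 0 with h | h | h
        · exact absurd (lineEnd_unique hiL.neg hkL'.neg (by simpa) (by simpa)) hi.2
        · simp [h]
        · exact absurd (lineEnd_unique hiL hkL h hk) hi.1
      · rw [if_neg hiL]
  · push Not at hex
    refine Finset.sum_eq_zero fun i _ => ?_
    by_cases hiL : LineEnd a d i
    · rw [if_pos hiL]
      rcases lt_trichotomy (d i) 0 with h | h | h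
      · obtain ⟨k', hk', hkL'⟩ := exists_lineEnd_neg hgen' (by simpa using hpos) hiL.neg (by simpa)
        exact absurd (by simpa using hkL'.neg) (hex k' (by simpa using hk'))
      · simp [h]
      · exact absurd hiL (hex i h)
    · rw [if_neg hiL]

end Line

variable {ι : Type*} [Fintype ι] [DecidableEq ι]

/-- `q` lies in the open cone generated by the rows of `C`. -/
def InCone (q : ι → ℝ) (C : Matrix ι ι ℝ) : Prop := ∃ a : ι → ℝ, (∀ i, 0 < a i) ∧ a ᵥ* C = q

open Classical in
/-- The signed indicator function of the cone generated by the rows of `C`. -/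
noncomputable def coneSign (q : ι → ℝ) (C : Matrix ι ι ℝ) : ℤ :=
  if InCone q C then ((SignType.sign C.det : SignType) : ℤ) else 0

/-- The linear relation between `p` and the rows of `C`; its coefficients give the direction of the
line in `coneSign_eq_sum`. -/
theorem cramer_relation (C : Matrix ι ι ℝ) (p : ι → ℝ) :
    (fun i => (C.updateRow i p).det) ᵥ* C = C.det • p := by
  have := Matrix.mulVec_cramer Cᵀ p
  rw [Matrix.mulVec_transpose, Matrix.det_transpose] at this
  rw [← this]
  congr 1
  ext i
  rw [Matrix.cramer_transpose_apply]

/-- Turns a representation over the matrix with `p` in row `i` into one over `p` and all rows of `C`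
with coefficient 0 at row `i`. -/
theorem vecMul_updateRow (C : Matrix ι ι ℝ) (p a : ι → ℝ) (i : ι) :
    a ᵥ* (C.updateRow i p) = a i • p + (Function.update a i 0) ᵥ* C := by
  ext j
  simp only [Matrix.vecMul, dotProduct, Pi.add_apply, Pi.smul_apply, smul_eq_mul]
  rw [← Finset.add_sum_erase _ _ (Finset.mem_univ i),
    ← Finset.add_sum_erase (a := i) _ (fun x => Function.update a i 0 x * C x j) (Finset.mem_univ i)]
  simp only [Matrix.updateRow_self, Function.update_self, zero_mul, zero_add]
  congr 1
  refine Finset.sum_congr rfl fun k hk => ?_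
  have := Finset.ne_of_mem_erase hk
  rw [Matrix.updateRow_ne this, Function.update_of_ne this]

/-- The cocycle relation of the signed indicator functions of simplicial cones. -/
theorem coneSign_eq_sum (C : Matrix ι ι ℝ) (p q u : ι → ℝ) (hC : ∀ i, 0 < C i ⬝ᵥ u)
    (hp : 0 < p ⬝ᵥ u)
    (hgen : ∀ (b : ℝ) (a : ι → ℝ), 0 ≤ b → (∀ i, 0 ≤ a i) → b • p + a ᵥ* C = q →
      (∀ i, a i = 0 → b ≠ 0) ∧ ∀ i j, a i = 0 → a j = 0 → i = j) :
    coneSign q C = ∑ i, coneSign q (C.updateRow i p) := by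
  classical
  -- The index `none` stands for `p` and `some i` for row `i` of `C`.
  let d : Option ι → ℝ := fun k => k.elim C.det fun i => -(C.updateRow i p).det
  have hd : d none • p + (fun i => d (some i)) ᵥ* C = 0 := by
    have := cramer_relation C p
    have e : (fun i => d (some i)) = -fun i => (C.updateRow i p).det := rfl
    rw [e, Matrix.neg_vecMul, this]
    simp [d]
  -- If all these determinants vanish, so do all signed indicators.
  by_cases hd0 : ∀ k, d k = 0
  · have h0 : C.det = 0 := hd0 none
    have h1 : ∀ i, (C.updateRow i p).det = 0 := fun i => by simpa [d] using hd0 (some i)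
    simp [coneSign, h0, h1]
  -- Pairing the relation with `u` gives a vanishing sum with positive weights, so `d` takes both
  -- signs and the segment is bounded in both directions.
  · have hdu : d none * (p ⬝ᵥ u) + ∑ i, d (some i) * (C i ⬝ᵥ u) = 0 := by
      have := congrArg (· ⬝ᵥ u) hd
      simp only [add_dotProduct, smul_dotProduct, zero_dotProduct, smul_eq_mul] at this
      rw [← Matrix.dotProduct_mulVec] at this
      exact this
    have hdu' : ∑ k : Option ι, d k * (k.elim (p ⬝ᵥ u) fun i => C i ⬝ᵥ u) = 0 := by
      rw [Fintype.sum_option]; exact hdu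
    have hV : ∀ k : Option ι, 0 < (k.elim (p ⬝ᵥ u) fun i => C i ⬝ᵥ u) := by
      rintro (_ | i)
      · exact hp
      · exact hC i
    have hneg : ∃ k, d k < 0 := by
      by_contra! h
      refine hd0 fun k => ?_
      have := (Finset.sum_eq_zero_iff_of_nonneg
        (fun k _ => mul_nonneg (h k) (hV k).le)).1 hdu' k (Finset.mem_univ k)
      exact (mul_eq_zero.1 this).resolve_right (hV k).ne'
    have hpos : ∃ k, 0 < d k := by
      by_contra! h
      refine hd0 fun k => ?_
      have := (Finset.sum_eq_zero_iff_of_nonpos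
        (fun k _ => mul_nonpos_of_nonpos_of_nonneg (h k) (hV k).le)).1 hdu' k (Finset.mem_univ k)
      exact (mul_eq_zero.1 this).resolve_right (hV k).ne'
    -- a base point and uniqueness of the line
    have hker : ∀ k, d k ≠ 0 → ∀ e : Option ι → ℝ,
        e none • p + (fun i => e (some i)) ᵥ* C = 0 → e k = 0 → e = 0 := by
      rintro (_ | i) hk e he hek
      · rw [hek, zero_smul, zero_add] at he
        have := Matrix.eq_zero_of_vecMul_eq_zero (M := C) hk he
        ext (_ | j)
        · exact hek
        · exact congrFun this j
      · have hk' : (C.updateRow i p).det ≠ 0 := by simpa [d] using hk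
        have : (Function.update (fun i => e (some i)) i (e none)) ᵥ* (C.updateRow i p) = 0 := by
          rw [vecMul_updateRow, Function.update_self, Function.update_idem, ← he]
          congr 2
          rw [Function.update_eq_self_iff, hek]
        have := Matrix.eq_zero_of_vecMul_eq_zero hk' this
        have hn : e none = 0 := by simpa using congrFun this i
        ext (_ | j)
        · exact hn
        · by_cases hj : j = i
          · rw [hj, hek]; rfl
          · simpa [Function.update_of_ne hj] using congrFun this j
    have hbase : ∃ a : Option ι → ℝ, a none • p + (fun i => a (some i)) ᵥ* C = q := by
      obtain ⟨k, hk⟩ := not_forall.1 hd0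
      rcases k with _ | i
      · refine ⟨fun k => k.elim 0 (q ᵥ* C⁻¹), ?_⟩
        have : IsUnit C.det := isUnit_iff_ne_zero.2 hk
        simp [Matrix.vecMul_vecMul, Matrix.nonsing_inv_mul _ this]
      · have hk' : IsUnit (C.updateRow i p).det := isUnit_iff_ne_zero.2 (by simpa [d] using hk)
        set b := q ᵥ* (C.updateRow i p)⁻¹ with hb
        have h1 : b ᵥ* (C.updateRow i p) = q := by
          rw [hb, Matrix.vecMul_vecMul, Matrix.nonsing_inv_mul _ hk', Matrix.vecMul_one]
        rw [vecMul_updateRow] at h1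
        exact ⟨fun k => k.elim (b i) (Function.update b i 0), h1⟩
    obtain ⟨a, ha⟩ := hbase
    have hline : ∀ t : ℝ, (a none + t * d none) • p + (fun i => a (some i) + t * d (some i)) ᵥ* C
        = q := by
      intro t
      have : (fun i => a (some i) + t * d (some i)) =
        (fun i => a (some i)) + t • fun i => d (some i) := rfl
      rw [this, Matrix.add_vecMul, Matrix.smul_vecMul, add_smul, mul_smul]
      have := congrArg (t • ·) hd
      simp only [smul_add, smul_zero] at this
      rw [add_add_add_comm, ha, this, add_zero]
    -- Every representation of `q` lies on the line, because a nonzero coordinate of `d` determines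
    -- the parameter.
    have hon : ∀ k, d k ≠ 0 → ∀ e : Option ι → ℝ, e none • p + (fun i => e (some i)) ᵥ* C = q →
        ∃ t, ∀ j, e j = a j + t * d j := by
      intro k hk e he
      refine ⟨(e k - a k) / d k, fun j => ?_⟩
      have := hker k hk (fun j => e j - (a j + (e k - a k) / d k * d j)) ?_ ?_
      · exact sub_eq_zero.1 (congrFun this j)
      · rw [sub_smul]
        have e1 : (fun i => e (some i) - (a (some i) + (e k - a k) / d k * d (some i))) =
          (fun i => e (some i)) - fun i => a (some i) + (e k - a k) / d k * d (some i) := rfl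
        rw [e1, Matrix.sub_vecMul, sub_add_sub_comm, he, hline, sub_self]
      · field_simp
        ring
    have hgen' : ∀ t, (∀ i, 0 ≤ a i + t * d i) → ∀ k k', a k + t * d k = 0 →
        a k' + t * d k' = 0 → k = k' := by
      intro t ht k k' hk hk'
      obtain ⟨g1, g2⟩ := hgen _ _ (ht none) (fun i => ht (some i)) (hline t)
      rcases k with _ | i <;> rcases k' with _ | j
      · rfl
      · exact absurd hk (g1 j hk')
      · exact absurd hk' (g1 i hk)
      · rw [g2 i j hk hk']
    have hsum := sum_sign_lineEnd hgen' hneg hpos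
    rw [Fintype.sum_option] at hsum
    -- Lying in the open cone of `C` means that the segment has an end where the coefficient of `p`
    -- vanishes.
    have t0 : coneSign q C = if LineEnd a d none then ((SignType.sign (d none) : SignType) : ℤ)
        else 0 := by
      by_cases h0 : d none = 0
      · have : C.det = 0 := h0
        simp [coneSign, this, h0]
      · have : InCone q C ↔ LineEnd a d none := by
          constructor
          · rintro ⟨b, hb, hbq⟩
            obtain ⟨t, ht⟩ := hon none h0 (fun k => k.elim 0 b) (by simpa using hbq)
            refine ⟨t, (ht none).symm, ?_⟩
            rintro (_ | i) hi
            · exact absurd rfl hi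
            · rw [← ht]; exact hb i
          · rintro ⟨t, h1, h2⟩
            refine ⟨fun i => a (some i) + t * d (some i), fun i => h2 _ (by simp), ?_⟩
            have := hline t
            rwa [h1, zero_smul, zero_add] at this
        simp only [coneSign, this]
        rfl
    -- Likewise for the cones containing `p`; the minus sign is that of `d (some i)`.
    have ti : ∀ i, coneSign q (C.updateRow i p) =
        -(if LineEnd a d (some i) then ((SignType.sign (d (some i)) : SignType) : ℤ) else 0) := by
      intro i
      by_cases h0 : d (some i) = 0
      · have : (C.updateRow i p).det = 0 := by simpa [d] using h0
        simp [coneSign, this, h0]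
      · have : InCone q (C.updateRow i p) ↔ LineEnd a d (some i) := by
          constructor
          · rintro ⟨b, hb, hbq⟩
            rw [vecMul_updateRow] at hbq
            obtain ⟨t, ht⟩ := hon (some i) h0 (fun k => k.elim (b i) (Function.update b i 0)) hbq
            refine ⟨t, by rw [← ht]; simp, ?_⟩
            rintro (_ | j) hj
            · rw [← ht]; exact hb i
            · rw [← ht]
              have : j ≠ i := fun e => hj (by rw [e])
              simpa [Function.update_of_ne this] using hb j
          · rintro ⟨t, h1, h2⟩
            refine ⟨Function.update (fun j => a (some j) + t * d (some j)) i (a none + t * d none),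
              fun j => ?_, ?_⟩
            · by_cases hj : j = i
              · rw [hj, Function.update_self]; exact h2 _ (by simp)
              · rw [Function.update_of_ne hj]; exact h2 _ (by simpa using hj)
            · rw [vecMul_updateRow, Function.update_self, Function.update_idem]
              have e : Function.update (fun j => a (some j) + t * d (some j)) i 0 =
                  fun j => a (some j) + t * d (some j) := by
                rw [Function.update_eq_self_iff, h1]
              rw [e, hline]
        simp only [coneSign, this]
        split_ifs
        · have : d (some i) = -(C.updateRow i p).det := rfl
          rw [this, Left.sign_neg]
          simp
        · simp
    rw [t0, Finset.sum_congr rfl fun i _ => ti i, Finset.sum_neg_distrib]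
    exact eq_neg_of_add_eq_zero_left hsum

/-- Row `i` of `mixRows E F S` is row `i` of `F` if `i ∈ S`, and row `i` of `E` otherwise. -/
def mixRows (E F : Matrix ι ι ℝ) (S : Finset ι) : Matrix ι ι ℝ :=
  Matrix.of fun i => if i ∈ S then F i else E i

/-- The signed indicator functions of the `2 ^ |ι|` cones generated by complementary rows of `E` and
`F` add up to zero. -/
theorem sum_coneSign_mixRows [Nonempty ι] (E F : Matrix ι ι ℝ) (q u : ι → ℝ)
    (hE : ∀ i, 0 < E i ⬝ᵥ u) (hF : ∀ i, 0 < F i ⬝ᵥ u)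
    (hq : ∀ S a, (∀ i, 0 ≤ a i) → a ᵥ* mixRows E F S = q → ∀ i, 0 < a i) :
    ∑ S : Finset ι, (-1) ^ S.card * coneSign q (mixRows E F S) = 0 := by
  classical
  have hS : ∀ S i, 0 < mixRows E F S i ⬝ᵥ u := by
    intro S i
    change 0 < (if i ∈ S then F i else E i) ⬝ᵥ u
    split_ifs
    · exact hF i
    · exact hE i
  -- The proper subspaces that a generic `p` must avoid: the hyperplane orthogonal to `u`, and each
  -- span of `q` with all but two rows of a mixed matrix.
  let W : Option (Finset ι × {ij : ι × ι // ij.1 ≠ ij.2}) → Submodule ℝ (ι → ℝ) := fun k => k.elim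
    (LinearMap.ker (dotProductBilin ℝ ℝ u)) fun k => Submodule.span ℝ
      ((insert q ((Finset.univ.erase k.2.1.1).erase k.2.1.2 |>.image (mixRows E F k.1)) :
        Finset (ι → ℝ)) : Set (ι → ℝ))
  obtain ⟨p₀, hp₀⟩ := Submodule.exists_forall_notMem_of_forall_ne_top W (by
    rintro (_ | ⟨S, ⟨i, j⟩, hij⟩) h
    · obtain ⟨i⟩ := ‹Nonempty ι›
      have : E i ∈ (⊤ : Submodule ℝ (ι → ℝ)) := trivial
      rw [← h] at this
      have h2 : u ⬝ᵥ E i = 0 := this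
      rw [dotProduct_comm] at h2
      exact (hE i).ne' h2
    · have h1 := finrank_span_finset_le_card (R := ℝ)
        (insert q ((Finset.univ.erase i).erase j |>.image (mixRows E F S)) : Finset (ι → ℝ))
      have h2 : Submodule.span ℝ
        ((insert q ((Finset.univ.erase i).erase j |>.image (mixRows E F S)) :
        Finset (ι → ℝ)) : Set (ι → ℝ)) = ⊤ := h
      rw [Set.finrank, h2, finrank_top, Module.finrank_fintype_fun_eq_card] at h1
      have h3 := Finset.card_insert_le q ((Finset.univ.erase i).erase j |>.image (mixRows E F S))
      have h4 := Finset.card_image_le (s := (Finset.univ.erase i).erase j) (f := mixRows E F S)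
      rw [Finset.card_erase_of_mem (by simpa using hij.symm),
        Finset.card_erase_of_mem (Finset.mem_univ i), Finset.card_univ] at h4
      have h5 : 2 ≤ Fintype.card ι := Fintype.one_lt_card_iff.2 ⟨i, j, hij⟩
      omega)
  -- Subspaces are stable under negation, so `p` may be taken on the positive side of `u`.
  obtain ⟨p, hpu, hp⟩ : ∃ p, 0 < p ⬝ᵥ u ∧ ∀ S ij, p ∉ W (some (S, ij)) := by
    have h0 : u ⬝ᵥ p₀ ≠ 0 := hp₀ none
    rw [dotProduct_comm] at h0
    rcases lt_or_gt_of_ne h0 with h | h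
    · exact ⟨-p₀, by simpa using h, fun S ij hm => hp₀ _ (neg_mem_iff.1 hm)⟩
    · exact ⟨p₀, h, fun S ij => hp₀ _⟩
  have hco : ∀ S, coneSign q (mixRows E F S) =
      ∑ i, coneSign q ((mixRows E F S).updateRow i p) := by
    intro S
    refine coneSign_eq_sum _ p q u (hS S) hpu fun b a hb ha hba => ?_
    have g1 : ∀ i, a i = 0 → b ≠ 0 := by
      rintro i hi rfl
      rw [zero_smul, zero_add] at hba
      exact (hq S a ha hba i).ne' hi
    refine ⟨g1, fun i j hi hj => ?_⟩
    by_contra hij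
    -- Two vanishing coefficients would put `p` into the span of `q` and the remaining rows.
    refine hp S ⟨(i, j), hij⟩ ?_
    have hb0 := g1 i hi
    have e : p = b⁻¹ • (q - a ᵥ* mixRows E F S) := by
      rw [← hba, add_sub_cancel_right, smul_smul, inv_mul_cancel₀ hb0, one_smul]
    rw [e]
    refine Submodule.smul_mem _ _ (Submodule.sub_mem _ (Submodule.subset_span (by simp)) ?_)
    rw [Matrix.vecMul_eq_sum]
    refine Submodule.sum_mem _ fun k _ => ?_
    by_cases hk : a k = 0
    · rw [hk, zero_smul]; exact Submodule.zero_mem _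
    · refine Submodule.smul_mem _ _ (Submodule.subset_span ?_)
      have : k ≠ i ∧ k ≠ j := ⟨fun e => hk (e ▸ hi), fun e => hk (e ▸ hj)⟩
      rw [Finset.mem_coe]
      exact Finset.mem_insert_of_mem (Finset.mem_image_of_mem _ (by simp [this]))
  simp only [hco, Finset.mul_sum]
  rw [Finset.sum_comm]
  refine Finset.sum_eq_zero fun i _ => ?_
  -- Row `i` is overwritten by `p`, so it no longer matters whether `i` lies in `S`; only the parity
  -- of the cardinality changes.
  refine Finset.sum_involution (fun S _ => symmDiff S {i}) ?_ ?_ (by simp) (by simp)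
  · intro S _
    have hrow : (mixRows E F (symmDiff S {i})).updateRow i p = (mixRows E F S).updateRow i p := by
      ext j k
      by_cases hj : j = i
      · subst hj; simp
      · rw [Matrix.updateRow_ne hj, Matrix.updateRow_ne hj]
        simp [mixRows, Finset.mem_symmDiff, hj]
    rw [hrow, ← add_mul]
    have hc : ((-1 : ℤ) ^ S.card + (-1) ^ (symmDiff S {i}).card) = 0 := by
      by_cases hi : i ∈ S
      · have : S = insert i (symmDiff S {i}) := by
          ext j; simp [Finset.mem_symmDiff]; by_cases hj : j = i <;> simp [hj, hi]
        have hn : i ∉ symmDiff S {i} := by simp [Finset.mem_symmDiff, hi]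
        have := congrArg Finset.card this
        rw [Finset.card_insert_of_notMem hn] at this
        rw [this, pow_succ]; ring
      · have : symmDiff S {i} = insert i S := by
          ext j; simp [Finset.mem_symmDiff]; by_cases hj : j = i <;> simp [hj, hi]
        rw [this, Finset.card_insert_of_notMem hi, pow_succ]; ring
    rw [hc, zero_mul]
  · intro S _ _ h
    have : i ∈ symmDiff S {i} ↔ i ∈ S := by rw [h]
    simp [Finset.mem_symmDiff] at this

/-- A cone whose relative interior contains a nondegenerate point is simplicial. -/
theorem det_ne_zero_of_inCone {C : Matrix ι ι ℝ} {q u : ι → ℝ} (hC : ∀ i, 0 < C i ⬝ᵥ u)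
    (hq : ∀ a, (∀ i, 0 ≤ a i) → a ᵥ* C = q → ∀ i, 0 < a i) (h : InCone q C) : C.det ≠ 0 := by
  intro hdet
  obtain ⟨a, ha, haq⟩ := h
  obtain ⟨d, hd0, hd⟩ := Matrix.exists_vecMul_eq_zero_iff.2 hdet
  have hdu : ∑ i, d i * (C i ⬝ᵥ u) = 0 := by
    have := congrArg (· ⬝ᵥ u) hd
    simp only [zero_dotProduct] at this
    rw [← Matrix.dotProduct_mulVec] at this
    exact this
  have hneg : ∃ k, d k < 0 := by
    by_contra! h
    refine hd0 (funext fun k => ?_)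
    have := (Finset.sum_eq_zero_iff_of_nonneg
      (fun k _ => mul_nonneg (h k) (hC k).le)).1 hdu k (Finset.mem_univ k)
    exact (mul_eq_zero.1 this).resolve_right (hC k).ne'
  obtain ⟨k₀, hk₀⟩ := hneg
  obtain ⟨k, hk, hmin⟩ := Finset.exists_min_image (Finset.univ.filter fun k => d k < 0)
    (fun j => a j / (-d j)) ⟨k₀, by simpa using hk₀⟩
  simp only [Finset.mem_filter, Finset.mem_univ, true_and] at hk hmin
  have h0 : 0 ≤ a k / (-d k) := div_nonneg (ha k).le (by linarith)
  -- Moving along the relation `d` until the first coordinate vanishes gives a nonnegative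
  -- representation of `q` with a zero coefficient.
  have := hq (a + (a k / (-d k)) • d) (fun i => ?_) ?_ k
  · have hz : a k + a k / (-d k) * d k = 0 := by
      have := hk.ne
      field_simp
      ring
    exact this.ne' hz
  · rcases lt_or_ge (d i) 0 with hi | hi
    · have := hmin i hi
      rw [le_div_iff₀ (by linarith)] at this
      simp only [Pi.add_apply, Pi.smul_apply, smul_eq_mul]
      linarith
    · simp only [Pi.add_apply, Pi.smul_apply, smul_eq_mul]
      have := ha i
      positivity
  · rw [Matrix.add_vecMul, Matrix.smul_vecMul, hd, smul_zero, add_zero, haq]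

end IndexSum

/-! ### Equilibria as complementary solutions, and the index theorem -/

section Game

variable {m n : ℕ} {A B : Matrix (Fin m) (Fin n) ℝ}

theorem mem_supp {k : ℕ} {x : Fin k → ℝ} {i : Fin k} : i ∈ supp x ↔ 0 < x i := by simp [supp]

theorem notMem_supp {k : ℕ} {x : Fin k → ℝ} (hx : ∀ i, 0 ≤ x i) {i : Fin k} :
    i ∉ supp x ↔ x i = 0 := by
  rw [mem_supp, not_lt]
  exact ⟨fun h => le_antisymm h (hx i), fun h => h.le⟩

theorem inl_mem_labelP {v : (Fin n → ℝ) × ℝ} {i : Fin m} :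
    Sum.inl i ∈ labelP A v ↔ (A *ᵥ v.1) i = v.2 := by simp [labelP]

theorem inr_mem_labelP {v : (Fin n → ℝ) × ℝ} {j : Fin n} :
    Sum.inr j ∈ labelP A v ↔ v.1 j = 0 := by simp [labelP]

theorem inl_mem_labelQ {w : (Fin m → ℝ) × ℝ} {i : Fin m} :
    Sum.inl i ∈ labelQ B w ↔ w.1 i = 0 := by simp [labelQ]

theorem inr_mem_labelQ {w : (Fin m → ℝ) × ℝ} {j : Fin n} :
    Sum.inr j ∈ labelQ B w ↔ (w.1 ᵥ* B) j = w.2 := by simp [labelQ]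

theorem dotProduct_le_of_simplex {k : ℕ} {x g : Fin k → ℝ} {c : ℝ} (hx : x ∈ stdSimplex ℝ (Fin k))
    (hg : ∀ i, g i ≤ c) : x ⬝ᵥ g ≤ c := by
  calc x ⬝ᵥ g ≤ ∑ i, x i * c := Finset.sum_le_sum fun i _ => mul_le_mul_of_nonneg_left (hg i) (hx.1 i)
    _ = c := by rw [← Finset.sum_mul, hx.2, one_mul]

theorem dotProduct_eq_of_simplex {k : ℕ} {x g : Fin k → ℝ} {c : ℝ} (hx : x ∈ stdSimplex ℝ (Fin k))
    (hg : ∀ i, x i = 0 ∨ g i = c) : x ⬝ᵥ g = c := by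
  calc x ⬝ᵥ g = ∑ i, x i * c := Finset.sum_congr rfl fun i _ => by
        rcases hg i with h | h <;> rw [h]
        simp
    _ = c := by rw [← Finset.sum_mul, hx.2, one_mul]

theorem eq_zero_or_eq_of_dotProduct_eq {k : ℕ} {x g : Fin k → ℝ} {c : ℝ}
    (hx : x ∈ stdSimplex ℝ (Fin k)) (hg : ∀ i, g i ≤ c) (h : x ⬝ᵥ g = c) (i : Fin k) :
    x i = 0 ∨ g i = c := by
  have h0 : ∑ i, x i * (c - g i) = 0 := by
    simp only [mul_sub, Finset.sum_sub_distrib, ← Finset.sum_mul, hx.2, one_mul]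
    rw [← h]; simp [dotProduct]
  have := (Finset.sum_eq_zero_iff_of_nonneg
    (fun i _ => mul_nonneg (hx.1 i) (sub_nonneg.2 (hg i)))).1 h0 i (Finset.mem_univ i)
  rcases mul_eq_zero.1 this with h | h
  · exact Or.inl h
  · exact Or.inr (by linarith)

/-- Full labelling says that every pure strategy is unplayed or a best response. -/
theorem isNash_of_labels {x : Fin m → ℝ} {y : Fin n → ℝ} {π₁ π₂ : ℝ} (hy : (y, π₁) ∈ P A)
    (hx : (x, π₂) ∈ Q B) (h : labelP A (y, π₁) ∪ labelQ B (x, π₂) = Finset.univ) :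
    IsNash A B x y := by
  have hxs : x ∈ stdSimplex ℝ (Fin m) := ⟨hx.1, hx.2.2⟩
  have hys : y ∈ stdSimplex ℝ (Fin n) := ⟨hy.2.1, hy.2.2⟩
  refine ⟨hxs, hys, fun x' hx' => ?_, fun y' hy' => ?_⟩
  · rw [dotProduct_eq_of_simplex (c := π₁) hxs]
    · exact dotProduct_le_of_simplex hx' hy.1
    · intro i
      have : Sum.inl i ∈ labelP A (y, π₁) ∪ labelQ B (x, π₂) := h ▸ Finset.mem_univ _
      rw [Finset.mem_union, inl_mem_labelP, inl_mem_labelQ] at this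
      exact this.symm
  · rw [Matrix.dotProduct_mulVec, Matrix.dotProduct_mulVec, dotProduct_comm, dotProduct_comm _ y,
      dotProduct_eq_of_simplex (c := π₂) hys]
    · exact dotProduct_le_of_simplex hy' hx.2.1
    · intro j
      have : Sum.inr j ∈ labelP A (y, π₁) ∪ labelQ B (x, π₂) := h ▸ Finset.mem_univ _
      rw [Finset.mem_union, inr_mem_labelP, inr_mem_labelQ] at this
      exact this

theorem IsNash.mem_P {x : Fin m → ℝ} {y : Fin n → ℝ} (h : IsNash A B x y) :
    (y, x ⬝ᵥ A *ᵥ y) ∈ P A := by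
  refine ⟨fun i => ?_, h.2.1.1, h.2.1.2⟩
  have := h.2.2.1 (Pi.single i 1) (single_mem_stdSimplex ℝ i)
  simpa using this

theorem IsNash.mem_Q {x : Fin m → ℝ} {y : Fin n → ℝ} (h : IsNash A B x y) :
    (x, x ⬝ᵥ B *ᵥ y) ∈ Q B := by
  refine ⟨h.1.1, fun j => ?_, h.1.2⟩
  have := h.2.2.2 (Pi.single j 1) (single_mem_stdSimplex ℝ j)
  rw [Matrix.dotProduct_mulVec x B (Pi.single j 1)] at this
  simpa using this

theorem IsNash.row {x : Fin m → ℝ} {y : Fin n → ℝ} (h : IsNash A B x y) (i : Fin m) :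
    x i = 0 ∨ (A *ᵥ y) i = x ⬝ᵥ A *ᵥ y :=
  eq_zero_or_eq_of_dotProduct_eq h.1 h.mem_P.1 rfl i

theorem IsNash.col {x : Fin m → ℝ} {y : Fin n → ℝ} (h : IsNash A B x y) (j : Fin n) :
    y j = 0 ∨ (x ᵥ* B) j = x ⬝ᵥ B *ᵥ y :=
  eq_zero_or_eq_of_dotProduct_eq h.2.1 h.mem_Q.2.1
    (by rw [dotProduct_comm, Matrix.dotProduct_mulVec]) j

/-- At an equilibrium the rows in the support of `x` and the columns outside the support of `y` are
tight in `P`, and at most `n` labels are allowed. -/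
theorem card_supp_le_of_nondegP {x : Fin m → ℝ} {y : Fin n → ℝ} (hA : NondegP A)
    (h : IsNash A B x y) : (supp x).card ≤ (supp y).card := by
  have h1 := hA _ h.mem_P
  have h2 : (supp x).disjSum (supp y)ᶜ ⊆ labelP A (y, x ⬝ᵥ A *ᵥ y) := by
    rintro (i | j) hk
    · rw [Finset.inl_mem_disjSum, mem_supp] at hk
      rw [inl_mem_labelP]
      exact (h.row i).resolve_left hk.ne'
    · rw [Finset.inr_mem_disjSum, Finset.mem_compl, notMem_supp h.2.1.1] at hk
      rw [inr_mem_labelP]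
      exact hk
  have h3 := Finset.card_le_card h2
  rw [Finset.card_disjSum, Finset.card_compl, Fintype.card_fin] at h3
  have h4 := Finset.card_le_univ (supp y)
  rw [Fintype.card_fin] at h4
  omega

theorem card_supp_le_of_nondegQ {x : Fin m → ℝ} {y : Fin n → ℝ} (hB : NondegQ B)
    (h : IsNash A B x y) : (supp y).card ≤ (supp x).card := by
  have h1 := hB _ h.mem_Q
  have h2 : (supp x)ᶜ.disjSum (supp y) ⊆ labelQ B (x, x ⬝ᵥ B *ᵥ y) := by
    rintro (i | j) hk
    · rw [Finset.inl_mem_disjSum, Finset.mem_compl, notMem_supp h.1.1] at hk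
      rw [inl_mem_labelQ]
      exact hk
    · rw [Finset.inr_mem_disjSum, mem_supp] at hk
      rw [inr_mem_labelQ]
      exact (h.col j).resolve_left hk.ne'
  have h3 := Finset.card_le_card h2
  rw [Finset.card_disjSum, Finset.card_compl, Fintype.card_fin] at h3
  have h4 := Finset.card_le_univ (supp x)
  rw [Fintype.card_fin] at h4
  omega

theorem IsNash.card_supp_eq {x : Fin m → ℝ} {y : Fin n → ℝ} (hAB : Nondegenerate A B)
    (h : IsNash A B x y) : (supp x).card = (supp y).card :=
  le_antisymm (card_supp_le_of_nondegP hAB.1 h) (card_supp_le_of_nondegQ hAB.2 h)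

theorem supp_nonempty {k : ℕ} {x : Fin k → ℝ} (hx : x ∈ stdSimplex ℝ (Fin k)) :
    (supp x).Nonempty := by
  by_contra h
  rw [Finset.not_nonempty_iff_eq_empty] at h
  have h0 : ∀ i, x i = 0 := fun i => (notMem_supp hx.1).1 (by simp [h])
  have := hx.2
  simp [h0] at this

theorem payoff_pos {k l : ℕ} {M : Matrix (Fin k) (Fin l) ℝ} (hM : ∀ i j, 0 < M i j)
    {y : Fin l → ℝ} (hy : y ∈ stdSimplex ℝ (Fin l)) (i : Fin k) : 0 < (M *ᵥ y) i := by
  obtain ⟨j, hj⟩ := supp_nonempty hy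
  exact Finset.sum_pos' (fun j _ => mul_nonneg (hM i j).le (hy.1 j))
    ⟨j, Finset.mem_univ j, mul_pos (hM i j) (mem_supp.1 hj)⟩

theorem IsNash.payoff₁_pos (hA : ∀ i j, 0 < A i j) {x : Fin m → ℝ} {y : Fin n → ℝ}
    (h : IsNash A B x y) : 0 < x ⬝ᵥ A *ᵥ y := by
  obtain ⟨i, _⟩ := supp_nonempty h.1
  exact (payoff_pos hA h.2.1 i).trans_le (h.mem_P.1 i)

theorem IsNash.payoff₂_pos (hB : ∀ i j, 0 < B i j) {x : Fin m → ℝ} {y : Fin n → ℝ}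
    (h : IsNash A B x y) : 0 < x ⬝ᵥ B *ᵥ y := by
  obtain ⟨j, _⟩ := supp_nonempty h.2.1
  have := payoff_pos (M := Bᵀ) (fun i j => hB j i) h.1 j
  rw [Matrix.mulVec_transpose] at this
  exact this.trans_le (h.mem_Q.2.1 j)

/-! ### The linear complementarity problem of a bimatrix game -/

/-- The rows of the linear complementarity problem `z F + w = 1` of the game `(A, B)`. -/
def lcpRows (A B : Matrix (Fin m) (Fin n) ℝ) : Matrix (Fin m ⊕ Fin n) (Fin m ⊕ Fin n) ℝ :=
  Matrix.fromBlocks 0 B Aᵀ 0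

/-- `(z, w)` solves the linear complementarity problem of the game `(A, B)`. -/
structure IsComplementary (A B : Matrix (Fin m) (Fin n) ℝ) (z w : Fin m ⊕ Fin n → ℝ) : Prop where
  z_nonneg : ∀ k, 0 ≤ z k
  w_nonneg : ∀ k, 0 ≤ w k
  compl : ∀ k, z k = 0 ∨ w k = 0
  rows : ∀ i, (A *ᵥ fun j => z (Sum.inr j)) i + w (Sum.inl i) = 1
  cols : ∀ j, ((fun i => z (Sum.inl i)) ᵥ* B) j + w (Sum.inr j) = 1

/-- Splits the coefficients into z (on `S`) and w (off `S`), which are then complementary by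
construction. -/
theorem vecMul_mixRows_one {ι : Type*} [Fintype ι] [DecidableEq ι] (F : Matrix ι ι ℝ)
    (S : Finset ι) (a : ι → ℝ) :
    a ᵥ* mixRows 1 F S = (fun k => if k ∈ S then a k else 0) ᵥ* F +
      fun k => if k ∈ S then 0 else a k := by
  rw [← Matrix.vecMul_one (fun k => if k ∈ S then 0 else a k)]
  ext j
  simp only [Matrix.vecMul, dotProduct, Pi.add_apply]
  rw [← Finset.sum_add_distrib]
  refine Finset.sum_congr rfl fun k _ => ?_
  by_cases hk : k ∈ S <;> simp [mixRows, hk]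

theorem vecMul_lcpRows_inl (z : Fin m ⊕ Fin n → ℝ) (i : Fin m) :
    (z ᵥ* lcpRows A B) (Sum.inl i) = (A *ᵥ fun j => z (Sum.inr j)) i := by
  simp [lcpRows, Matrix.vecMul, dotProduct, Matrix.mulVec, mul_comm]

theorem vecMul_lcpRows_inr (z : Fin m ⊕ Fin n → ℝ) (j : Fin n) :
    (z ᵥ* lcpRows A B) (Sum.inr j) = ((fun i => z (Sum.inl i)) ᵥ* B) j := by
  simp [lcpRows, Matrix.vecMul, dotProduct]

theorem isComplementary_of_vecMul {S : Finset (Fin m ⊕ Fin n)} {a : Fin m ⊕ Fin n → ℝ}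
    (ha : ∀ k, 0 ≤ a k) (h : a ᵥ* mixRows 1 (lcpRows A B) S = fun _ => 1) :
    IsComplementary A B (fun k => if k ∈ S then a k else 0) (fun k => if k ∈ S then 0 else a k) := by
  rw [vecMul_mixRows_one] at h
  refine ⟨fun k => ?_, fun k => ?_, fun k => ?_, fun i => ?_, fun j => ?_⟩
  · split_ifs
    · exact ha k
    · exact le_rfl
  · split_ifs
    · exact le_rfl
    · exact ha k
  · by_cases hk : k ∈ S <;> simp [hk]
  · rw [← vecMul_lcpRows_inl (B := B) (fun k => if k ∈ S then a k else 0)]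
    exact congrFun h (Sum.inl i)
  · rw [← vecMul_lcpRows_inr (A := A) (fun k => if k ∈ S then a k else 0)]
    exact congrFun h (Sum.inr j)

theorem IsComplementary.vecMul {z w : Fin m ⊕ Fin n → ℝ} (h : IsComplementary A B z w)
    {S : Finset (Fin m ⊕ Fin n)} (hz : ∀ k ∉ S, z k = 0) (hw : ∀ k ∈ S, w k = 0) :
    (z + w) ᵥ* mixRows 1 (lcpRows A B) S = fun _ => 1 := by
  rw [vecMul_mixRows_one]
  have e1 : (fun k => if k ∈ S then (z + w) k else 0) = z := by
    ext k; split_ifs with hk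
    · simp [hw k hk]
    · rw [hz k hk]
  have e2 : (fun k => if k ∈ S then 0 else (z + w) k) = w := by
    ext k; split_ifs with hk
    · rw [hw k hk]
    · simp [hz k hk]
  rw [e1, e2]
  ext (i | j)
  · rw [Pi.add_apply, vecMul_lcpRows_inl, h.rows]
  · rw [Pi.add_apply, vecMul_lcpRows_inr, h.cols]

theorem IsComplementary.inl_of_inr {z w : Fin m ⊕ Fin n → ℝ} (h : IsComplementary A B z w)
    (h0 : ∀ j, z (Sum.inr j) = 0) (i : Fin m) : z (Sum.inl i) = 0 := by
  refine (h.compl _).resolve_right fun hw => ?_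
  have := h.rows i
  simp [h0, hw, Matrix.mulVec, dotProduct] at this

theorem IsComplementary.inr_of_inl {z w : Fin m ⊕ Fin n → ℝ} (h : IsComplementary A B z w)
    (h0 : ∀ i, z (Sum.inl i) = 0) (j : Fin n) : z (Sum.inr j) = 0 := by
  refine (h.compl _).resolve_right fun hw => ?_
  have := h.cols j
  simp [h0, hw, Matrix.vecMul, dotProduct] at this

/-- If one half of z vanishes, the equations for that half give w = 1 on the other side, and
complementarity kills the other half too. So every nonzero solution can be normalised to mixed
strategies. -/
theorem IsComplementary.eq_zero_or_pos {z w : Fin m ⊕ Fin n → ℝ} (h : IsComplementary A B z w) :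
    (∀ k, z k = 0) ∨ (0 < ∑ i, z (Sum.inl i) ∧ 0 < ∑ j, z (Sum.inr j)) := by
  by_cases h1 : ∑ i, z (Sum.inl i) = 0
  · left
    have h1' : ∀ i, z (Sum.inl i) = 0 := fun i =>
      (Finset.sum_eq_zero_iff_of_nonneg (fun i _ => h.z_nonneg _)).1 h1 i (Finset.mem_univ i)
    rintro (i | j)
    · exact h1' i
    · exact h.inr_of_inl h1' j
  · by_cases h2 : ∑ j, z (Sum.inr j) = 0
    · left
      have h2' : ∀ j, z (Sum.inr j) = 0 := fun j =>
        (Finset.sum_eq_zero_iff_of_nonneg (fun i _ => h.z_nonneg _)).1 h2 j (Finset.mem_univ j)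
      rintro (i | j)
      · exact h.inl_of_inr h2' i
      · exact h2' j
    · right
      exact ⟨lt_of_le_of_ne (Finset.sum_nonneg fun i _ => h.z_nonneg _) (Ne.symm h1),
        lt_of_le_of_ne (Finset.sum_nonneg fun i _ => h.z_nonneg _) (Ne.symm h2)⟩

/-! ### From complementary solutions to points of the best response polyhedra -/

section Normalize

variable {z w : Fin m ⊕ Fin n → ℝ} (h : IsComplementary A B z w)
include h

theorem IsComplementary.mem_P (h2 : 0 < ∑ j, z (Sum.inr j)) :
    ((∑ j, z (Sum.inr j))⁻¹ • (fun j => z (Sum.inr j)), (∑ j, z (Sum.inr j))⁻¹) ∈ P A := by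
  refine ⟨fun i => ?_, fun j => ?_, ?_⟩
  · rw [Matrix.mulVec_smul, Pi.smul_apply, smul_eq_mul]
    have := h.rows i
    have := h.w_nonneg (Sum.inl i)
    exact mul_le_of_le_one_right (inv_pos.2 h2).le (by linarith)
  · exact mul_nonneg (inv_pos.2 h2).le (h.z_nonneg _)
  · simp only [Pi.smul_apply, smul_eq_mul]
    rw [← Finset.mul_sum, inv_mul_cancel₀ h2.ne']

theorem IsComplementary.mem_Q (h1 : 0 < ∑ i, z (Sum.inl i)) :
    ((∑ i, z (Sum.inl i))⁻¹ • (fun i => z (Sum.inl i)), (∑ i, z (Sum.inl i))⁻¹) ∈ Q B := by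
  refine ⟨fun i => ?_, fun j => ?_, ?_⟩
  · exact mul_nonneg (inv_pos.2 h1).le (h.z_nonneg _)
  · rw [Matrix.smul_vecMul, Pi.smul_apply, smul_eq_mul]
    have := h.cols j
    have := h.w_nonneg (Sum.inr j)
    exact mul_le_of_le_one_right (inv_pos.2 h1).le (by linarith)
  · simp only [Pi.smul_apply, smul_eq_mul]
    rw [← Finset.mul_sum, inv_mul_cancel₀ h1.ne']

theorem IsComplementary.mem_labelP (h2 : 0 < ∑ j, z (Sum.inr j)) (k : Fin m ⊕ Fin n) :
    k ∈ labelP A ((∑ j, z (Sum.inr j))⁻¹ • (fun j => z (Sum.inr j)), (∑ j, z (Sum.inr j))⁻¹) ↔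
      Sum.elim (fun i => w (Sum.inl i) = 0) (fun j => z (Sum.inr j) = 0) k := by
  rcases k with i | j
  · rw [inl_mem_labelP]
    simp only [Matrix.mulVec_smul, Pi.smul_apply, smul_eq_mul, Sum.elim_inl]
    rw [mul_eq_left₀ (inv_pos.2 h2).ne']
    have := h.rows i
    constructor <;> intro <;> linarith
  · rw [inr_mem_labelP]
    simp [h2.ne']

theorem IsComplementary.mem_labelQ (h1 : 0 < ∑ i, z (Sum.inl i)) (k : Fin m ⊕ Fin n) :
    k ∈ labelQ B ((∑ i, z (Sum.inl i))⁻¹ • (fun i => z (Sum.inl i)), (∑ i, z (Sum.inl i))⁻¹) ↔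
      Sum.elim (fun i => z (Sum.inl i) = 0) (fun j => w (Sum.inr j) = 0) k := by
  rcases k with i | j
  · rw [inl_mem_labelQ]
    simp [h1.ne']
  · rw [inr_mem_labelQ]
    simp only [Matrix.smul_vecMul, Pi.smul_apply, smul_eq_mul, Sum.elim_inr]
    rw [mul_eq_left₀ (inv_pos.2 h1).ne']
    have := h.cols j
    constructor <;> intro <;> linarith

theorem IsComplementary.label_union (h1 : 0 < ∑ i, z (Sum.inl i)) (h2 : 0 < ∑ j, z (Sum.inr j)) :
    labelP A ((∑ j, z (Sum.inr j))⁻¹ • (fun j => z (Sum.inr j)), (∑ j, z (Sum.inr j))⁻¹) ∪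
      labelQ B ((∑ i, z (Sum.inl i))⁻¹ • (fun i => z (Sum.inl i)), (∑ i, z (Sum.inl i))⁻¹) =
      Finset.univ := by
  ext k
  simp only [Finset.mem_union, h.mem_labelP h2, h.mem_labelQ h1, Finset.mem_univ, iff_true]
  have := h.compl k
  rcases k with i | j <;> simpa [or_comm] using this

/-- The two label sets cover all m + n labels and have at most n and m elements, so they are
disjoint; `z k = w k = 0` would make `k` a common label. For z = 0 the equations give w = 1. -/
theorem IsComplementary.pos (hAB : Nondegenerate A B) (k : Fin m ⊕ Fin n) : 0 < z k + w k := by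
  refine lt_of_le_of_ne (add_nonneg (h.z_nonneg k) (h.w_nonneg k)) fun h0 => ?_
  have hz : z k = 0 := by have := h.z_nonneg k; have := h.w_nonneg k; linarith
  have hw : w k = 0 := by linarith
  rcases h.eq_zero_or_pos with hzero | ⟨h1, h2⟩
  · rcases k with i | j
    · have := h.rows i
      simp [hzero, hw, Matrix.mulVec, dotProduct] at this
    · have := h.cols j
      simp [hzero, hw, Matrix.vecMul, dotProduct] at this
  · have c1 := hAB.1 _ (h.mem_P h2)
    have c2 := hAB.2 _ (h.mem_Q h1)
    have c3 := Finset.card_union_add_card_inter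
      (labelP A ((∑ j, z (Sum.inr j))⁻¹ • (fun j => z (Sum.inr j)), (∑ j, z (Sum.inr j))⁻¹))
      (labelQ B ((∑ i, z (Sum.inl i))⁻¹ • (fun i => z (Sum.inl i)), (∑ i, z (Sum.inl i))⁻¹))
    rw [h.label_union h1 h2, Finset.card_univ, Fintype.card_sum, Fintype.card_fin,
      Fintype.card_fin] at c3
    have c4 : 0 < (labelP A ((∑ j, z (Sum.inr j))⁻¹ • (fun j => z (Sum.inr j)),
        (∑ j, z (Sum.inr j))⁻¹) ∩ labelQ B ((∑ i, z (Sum.inl i))⁻¹ • (fun i => z (Sum.inl i)),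
        (∑ i, z (Sum.inl i))⁻¹)).card := by
      refine Finset.card_pos.2 ⟨k, ?_⟩
      rw [Finset.mem_inter, h.mem_labelP h2, h.mem_labelQ h1]
      rcases k with i | j <;> simp [hz, hw]
    omega

end Normalize

theorem lcp_nondegenerate (hAB : Nondegenerate A B) (S : Finset (Fin m ⊕ Fin n))
    (a : Fin m ⊕ Fin n → ℝ) (ha : ∀ k, 0 ≤ a k)
    (h : a ᵥ* mixRows 1 (lcpRows A B) S = fun _ => 1) (k : Fin m ⊕ Fin n) : 0 < a k := by
  have := (isComplementary_of_vecMul ha h).pos hAB k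
  by_cases hk : k ∈ S <;> simpa [hk] using this

theorem one_dotProduct_one_pos {ι : Type*} [Fintype ι] [DecidableEq ι] (i : ι) :
    (0 : ℝ) < (1 : Matrix ι ι ℝ) i ⬝ᵥ fun _ => 1 := by
  simp [dotProduct, Matrix.one_apply]

theorem lcpRows_dotProduct_one_pos [NeZero m] [NeZero n] (hA : ∀ i j, 0 < A i j)
    (hB : ∀ i j, 0 < B i j) (k : Fin m ⊕ Fin n) : (0 : ℝ) < lcpRows A B k ⬝ᵥ fun _ => 1 := by
  rcases k with i | j
  · simpa [lcpRows, dotProduct] using Finset.sum_pos (fun j _ => hB i j) Finset.univ_nonempty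
  · simpa [lcpRows, dotProduct] using Finset.sum_pos (fun i _ => hA i j) Finset.univ_nonempty

theorem mixRows_dotProduct_one_pos [NeZero m] [NeZero n] (hA : ∀ i j, 0 < A i j)
    (hB : ∀ i j, 0 < B i j) (S : Finset (Fin m ⊕ Fin n)) (k : Fin m ⊕ Fin n) :
    (0 : ℝ) < mixRows 1 (lcpRows A B) S k ⬝ᵥ fun _ => 1 := by
  change (0 : ℝ) < (if k ∈ S then lcpRows A B k else (1 : Matrix _ _ ℝ) k) ⬝ᵥ fun _ => 1
  split_ifs
  · exact lcpRows_dotProduct_one_pos hA hB k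
  · exact one_dotProduct_one_pos k

/-- Each strategy is divided by the payoff of the opponent, so that best responses have value 1;
positivity of the matrices makes the payoffs positive. -/
theorem IsNash.isComplementary (hA : ∀ i j, 0 < A i j) (hB : ∀ i j, 0 < B i j)
    {x : Fin m → ℝ} {y : Fin n → ℝ} (h : IsNash A B x y) :
    IsComplementary A B (Sum.elim (fun i => (x ⬝ᵥ B *ᵥ y)⁻¹ * x i) (fun j => (x ⬝ᵥ A *ᵥ y)⁻¹ * y j))
      (Sum.elim (fun i => 1 - (x ⬝ᵥ A *ᵥ y)⁻¹ * (A *ᵥ y) i)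
        (fun j => 1 - (x ⬝ᵥ B *ᵥ y)⁻¹ * (x ᵥ* B) j)) := by
  have p1 := h.payoff₁_pos hA
  have p2 := h.payoff₂_pos hB
  refine ⟨?_, ?_, ?_, fun i => ?_, fun j => ?_⟩
  · rintro (i | j)
    · exact mul_nonneg (inv_pos.2 p2).le (h.1.1 i)
    · exact mul_nonneg (inv_pos.2 p1).le (h.2.1.1 j)
  · rintro (i | j)
    · have := h.mem_P.1 i
      simp only [Sum.elim_inl, sub_nonneg]
      rw [inv_mul_le_iff₀ p1, mul_one]
      exact this
    · have := h.mem_Q.2.1 j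
      simp only [Sum.elim_inr, sub_nonneg]
      rw [inv_mul_le_iff₀ p2, mul_one]
      exact this
  · rintro (i | j)
    · rcases h.row i with h0 | h0
      · left; simp [h0]
      · right; simp [h0, p1.ne']
    · rcases h.col j with h0 | h0
      · left; simp [h0]
      · right; simp [h0, p2.ne']
  · have : (fun j => (x ⬝ᵥ A *ᵥ y)⁻¹ * y j) = (x ⬝ᵥ A *ᵥ y)⁻¹ • y := rfl
    simp [this, Matrix.mulVec_smul]
  · have : (fun i => (x ⬝ᵥ B *ᵥ y)⁻¹ * x i) = (x ⬝ᵥ B *ᵥ y)⁻¹ • x := rfl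
    simp [this, Matrix.smul_vecMul]

theorem IsNash.vecMul_eq_one (hA : ∀ i j, 0 < A i j) (hB : ∀ i j, 0 < B i j)
    {x : Fin m → ℝ} {y : Fin n → ℝ} (h : IsNash A B x y) :
    (Sum.elim (fun i => (x ⬝ᵥ B *ᵥ y)⁻¹ * x i) (fun j => (x ⬝ᵥ A *ᵥ y)⁻¹ * y j) +
      Sum.elim (fun i => 1 - (x ⬝ᵥ A *ᵥ y)⁻¹ * (A *ᵥ y) i)
        (fun j => 1 - (x ⬝ᵥ B *ᵥ y)⁻¹ * (x ᵥ* B) j)) ᵥ*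
      mixRows 1 (lcpRows A B) ((supp x).disjSum (supp y)) = fun _ => 1 := by
  have p1 := h.payoff₁_pos hA
  have p2 := h.payoff₂_pos hB
  refine (h.isComplementary hA hB).vecMul ?_ ?_
  · rintro (i | j) hk
    · rw [Finset.inl_mem_disjSum, notMem_supp h.1.1] at hk
      simp [hk]
    · rw [Finset.inr_mem_disjSum, notMem_supp h.2.1.1] at hk
      simp [hk]
  · rintro (i | j) hk
    · rw [Finset.inl_mem_disjSum, mem_supp] at hk
      simp [(h.row i).resolve_left hk.ne', p1.ne']
    · rw [Finset.inr_mem_disjSum, mem_supp] at hk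
      simp [(h.col j).resolve_left hk.ne', p2.ne']

theorem IsNash.inCone (hAB : Nondegenerate A B) (hA : ∀ i j, 0 < A i j) (hB : ∀ i j, 0 < B i j)
    {x : Fin m → ℝ} {y : Fin n → ℝ} (h : IsNash A B x y) :
    InCone (fun _ => 1) (mixRows 1 (lcpRows A B) ((supp x).disjSum (supp y))) :=
  ⟨_, (h.isComplementary hA hB).pos hAB, h.vecMul_eq_one hA hB⟩

theorem det_mixRows_ne_zero [NeZero m] [NeZero n] (hAB : Nondegenerate A B)
    (hA : ∀ i j, 0 < A i j) (hB : ∀ i j, 0 < B i j) {S : Finset (Fin m ⊕ Fin n)}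
    (h : InCone (fun _ => 1) (mixRows 1 (lcpRows A B) S)) :
    (mixRows 1 (lcpRows A B) S).det ≠ 0 :=
  det_ne_zero_of_inCone (mixRows_dotProduct_one_pos hA hB S)
    (fun a ha => lcp_nondegenerate hAB S a ha) h

/-- In a nondegenerate game, an equilibrium is determined by its supports. -/
theorem IsNash.eq_of_supp_eq [NeZero m] [NeZero n] (hAB : Nondegenerate A B)
    (hA : ∀ i j, 0 < A i j) (hB : ∀ i j, 0 < B i j)
    {x x' : Fin m → ℝ} {y y' : Fin n → ℝ} (h : IsNash A B x y) (h' : IsNash A B x' y')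
    (hx : supp x = supp x') (hy : supp y = supp y') : x = x' ∧ y = y' := by
  have e := h.vecMul_eq_one hA hB
  have e' := h'.vecMul_eq_one hA hB
  rw [← hx, ← hy] at e'
  have hdet := det_mixRows_ne_zero hAB hA hB (h.inCone hAB hA hB)
  have hz := Matrix.eq_zero_of_vecMul_eq_zero hdet
    ((Matrix.sub_vecMul _ _ _).trans (sub_eq_zero.2 (e.trans e'.symm)))
  have hz' := fun k => congrFun (sub_eq_zero.1 hz) k
  have hX : ∀ i, (x ⬝ᵥ B *ᵥ y)⁻¹ * x i = (x' ⬝ᵥ B *ᵥ y')⁻¹ * x' i := by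
    intro i
    by_cases hi : i ∈ supp x
    · have := hz' (Sum.inl i)
      have hi' := hi
      rw [hx] at hi'
      simpa only [Pi.add_apply, Sum.elim_inl, (h.row i).resolve_left (mem_supp.1 hi).ne',
        (h'.row i).resolve_left (mem_supp.1 hi').ne', inv_mul_cancel₀ (h.payoff₁_pos hA).ne',
        inv_mul_cancel₀ (h'.payoff₁_pos hA).ne', sub_self, add_zero] using this
    · have hi' := hi
      rw [hx, notMem_supp h'.1.1] at hi'
      rw [notMem_supp h.1.1] at hi
      rw [hi, hi', mul_zero, mul_zero]
  have hY : ∀ j, (x ⬝ᵥ A *ᵥ y)⁻¹ * y j = (x' ⬝ᵥ A *ᵥ y')⁻¹ * y' j := by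
    intro j
    by_cases hj : j ∈ supp y
    · have := hz' (Sum.inr j)
      have hj' := hj
      rw [hy] at hj'
      simpa only [Pi.add_apply, Sum.elim_inr, (h.col j).resolve_left (mem_supp.1 hj).ne',
        (h'.col j).resolve_left (mem_supp.1 hj').ne', inv_mul_cancel₀ (h.payoff₂_pos hB).ne',
        inv_mul_cancel₀ (h'.payoff₂_pos hB).ne', sub_self, add_zero] using this
    · have hj' := hj
      rw [hy, notMem_supp h'.2.1.1] at hj'
      rw [notMem_supp h.2.1.1] at hj
      rw [hj, hj', mul_zero, mul_zero]
  have hX1 := Finset.sum_congr rfl fun i (_ : i ∈ Finset.univ) => hX i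
  rw [← Finset.mul_sum, ← Finset.mul_sum, h.1.2, h'.1.2, mul_one, mul_one] at hX1
  have hY1 := Finset.sum_congr rfl fun i (_ : i ∈ Finset.univ) => hY i
  rw [← Finset.mul_sum, ← Finset.mul_sum, h.2.1.2, h'.2.1.2, mul_one, mul_one] at hY1
  constructor
  · ext i
    have := hX i
    rw [hX1] at this
    exact mul_left_cancel₀ (inv_pos.2 (h'.payoff₂_pos hB)).ne' this
  · ext j
    have := hY j
    rw [hY1] at this
    exact mul_left_cancel₀ (inv_pos.2 (h'.payoff₁_pos hA)).ne' this

theorem exists_isNash_of_inCone {S : Finset (Fin m ⊕ Fin n)}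
    (hS : S.Nonempty) (h : InCone (fun _ => 1) (mixRows 1 (lcpRows A B) S)) :
    ∃ x y, IsNash A B x y ∧ (supp x).disjSum (supp y) = S := by
  obtain ⟨a, ha, haq⟩ := h
  have hc := isComplementary_of_vecMul (fun k => (ha k).le) haq
  obtain ⟨k, hk⟩ := hS
  rcases hc.eq_zero_or_pos with h0 | ⟨h1, h2⟩
  · have := h0 k
    simp only [if_pos hk] at this
    exact absurd this (ha k).ne'
  · refine ⟨_, _, isNash_of_labels (hc.mem_P h2) (hc.mem_Q h1) (hc.label_union h1 h2), ?_⟩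
    ext (i | j)
    · rw [Finset.inl_mem_disjSum, mem_supp, Pi.smul_apply, smul_eq_mul,
        mul_pos_iff_of_pos_left (inv_pos.2 h1)]
      by_cases hi : Sum.inl i ∈ S <;> simp [hi, ha]
    · rw [Finset.inr_mem_disjSum, mem_supp, Pi.smul_apply, smul_eq_mul,
        mul_pos_iff_of_pos_left (inv_pos.2 h2)]
      by_cases hi : Sum.inr j ∈ S <;> simp [hi, ha]

/-! ### The determinant of a complementary basis -/

/-- With the rows in I ⊔ J listed first, the unit rows split off and the two off-diagonal blocks
remain. Interchanging them costs (-1)^(|I||J|), which is (-1)^|I| since |I| = |J|. -/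
theorem det_mixRows_disjSum (A B : Matrix (Fin m) (Fin n) ℝ) {I : Finset (Fin m)}
    {J : Finset (Fin n)} (hIJ : I.card = J.card) :
    (mixRows 1 (lcpRows A B) (I.disjSum J)).det =
      (-1) ^ I.card * (listDet (listed I) (listed J) A * listDet (listed I) (listed J) B) := by
  let M : Fin m ⊕ Fin n → Fin m ⊕ Fin n → ℝ := fun k k' =>
    if k ∈ I.disjSum J then lcpRows A B k k' else (1 : Matrix _ _ ℝ) k k'
  have hM : mixRows 1 (lcpRows A B) (I.disjSum J) = Matrix.of M := by
    ext k k'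
    by_cases hk : k ∈ I.disjSum J <;> simp [mixRows, M, hk]
  rw [hM]
  let R : List (Fin m ⊕ Fin n) := (listed I).map Sum.inl ++ (listed J).map Sum.inr
  let T : List (Fin m ⊕ Fin n) := (listed Iᶜ).map Sum.inl ++ (listed Jᶜ).map Sum.inr
  have hR : ∀ k, k ∈ R ↔ k ∈ I.disjSum J := by
    rintro (i | j) <;> simp [R, mem_listed]
  have hT : ∀ k, k ∈ T ↔ k ∉ I.disjSum J := by
    rintro (i | j) <;> simp [T, mem_listed]
  have hnd : ∀ (I : Finset (Fin m)) (J : Finset (Fin n)),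
      ((listed I).map (Sum.inl : _ → Fin m ⊕ Fin n) ++ (listed J).map Sum.inr).Nodup := by
    intro I J
    refine List.Nodup.append ((nodup_listed I).map Sum.inl_injective)
      ((nodup_listed J).map Sum.inr_injective) ?_
    intro k hk hk'
    simp only [List.mem_map] at hk hk'
    obtain ⟨_, _, rfl⟩ := hk
    obtain ⟨_, _, h⟩ := hk'
    cases h
  have hMT : ∀ k ∈ T, ∀ k', M k k' = (1 : Matrix _ _ ℝ) k k' := by
    intro k hk k'
    rw [hT] at hk
    exact if_neg hk
  have hMR : ∀ k ∈ R, ∀ k', M k k' = lcpRows A B k k' := by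
    intro k hk k'
    rw [hR] at hk
    exact if_pos hk
  rw [det_eq_listDet (R ++ T)]
  · have key := listDet_append_diag (1 : ℝ) T (hnd _ _) id id R R M
      (fun k hk => by simp [hMT k hk]) (fun k hk k' _ hkk' => by simp [hMT k hk, hkk'])
      (fun k hk k' hk' => by
        rw [id, hMT k hk, Matrix.one_apply_ne]
        rintro rfl
        exact (hT k).1 hk ((hR k).1 hk'))
    rw [List.map_id, one_pow, one_mul] at key
    rw [key, listDet_congr (M' := fun k k' => lcpRows A B k k') (fun k hk k' _ => hMR k hk k'), ← listDet_transpose R R]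
    have sw := listDet_append_comm [] ((listed I).map Sum.inl) ((listed J).map Sum.inr) R
      (fun c r => lcpRows A B r c)
    simp only [List.nil_append, List.length_map, length_listed] at sw
    rw [sw, listDet_block (by simp [length_listed, hIJ])
      (by simp [lcpRows]), listDet_map, listDet_map, ← hIJ]
    have e1 : listDet (listed J) (listed I) (fun r c => lcpRows A B (Sum.inl c) (Sum.inr r)) =
      listDet (listed I) (listed J) B := listDet_transpose (listed I) (listed J) B
    have e2 : listDet (listed I) (listed J) (fun r c => lcpRows A B (Sum.inr c) (Sum.inl r)) =
      listDet (listed I) (listed J) A := rfl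
    rw [e1, e2]
    have e3 : (-1 : ℝ) ^ (I.card * I.card) = (-1) ^ I.card := by
      rcases Nat.even_or_odd I.card with h | h
      · rw [h.neg_one_pow, (h.mul_left _).neg_one_pow]
      · rw [h.neg_one_pow, (h.mul h).neg_one_pow]
    rw [e3]
    ring
  · refine List.Nodup.append (hnd _ _) (hnd _ _) ?_
    intro k hk hk'
    exact (hT k).1 hk' ((hR k).1 hk)
  · intro k
    rw [List.mem_append, hR, hT]
    exact em _

theorem IsNash.index_eq (hAB : Nondegenerate A B) {x : Fin m → ℝ} {y : Fin n → ℝ}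
    (h : IsNash A B x y) : index A B x y =
      -((SignType.sign (mixRows 1 (lcpRows A B) ((supp x).disjSum (supp y))).det : SignType) : ℤ) := by
  rw [det_mixRows_disjSum A B (h.card_supp_eq hAB), index]
  rcases Nat.even_or_odd (supp x).card with h | h
  · rw [h.neg_one_pow, one_mul, h.add_one.neg_one_pow, neg_one_mul]
  · rw [h.neg_one_pow, h.add_one.neg_one_pow, one_mul, neg_one_mul, Left.sign_neg]
    simp

theorem IsNash.index_eq_one_or [NeZero m] [NeZero n] (hAB : Nondegenerate A B)
    (hA : ∀ i j, 0 < A i j) (hB : ∀ i j, 0 < B i j) {x : Fin m → ℝ} {y : Fin n → ℝ}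
    (h : IsNash A B x y) : index A B x y = 1 ∨ index A B x y = -1 := by
  rw [h.index_eq hAB]
  rcases lt_or_gt_of_ne (det_mixRows_ne_zero hAB hA hB (h.inCone hAB hA hB)) with hd | hd
  · left; simp [sign_neg hd]
  · right; simp [sign_pos hd]

/-! ### The index theorem -/

theorem injOn_supp [NeZero m] [NeZero n] (hAB : Nondegenerate A B) (hA : ∀ i j, 0 < A i j)
    (hB : ∀ i j, 0 < B i j) :
    Set.InjOn (fun z : (Fin m → ℝ) × (Fin n → ℝ) => (supp z.1).disjSum (supp z.2))
      {z | IsNash A B z.1 z.2} := by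
  rintro ⟨x, y⟩ h ⟨x', y'⟩ h' heq
  obtain ⟨h1, h2⟩ := Finset.disjSum_inj.1 heq
  obtain ⟨rfl, rfl⟩ := IsNash.eq_of_supp_eq hAB hA hB h h' h1 h2
  rfl

theorem finite_isNash [NeZero m] [NeZero n] (hAB : Nondegenerate A B) (hA : ∀ i j, 0 < A i j)
    (hB : ∀ i j, 0 < B i j) : {z : (Fin m → ℝ) × (Fin n → ℝ) | IsNash A B z.1 z.2}.Finite :=
  Set.Finite.of_finite_image (Set.toFinite _) (injOn_supp hAB hA hB)

/-- The empty set is the artificial equilibrium z = 0, w = 1, with contribution +1. Any other cone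
containing (1, …, 1) belongs to exactly one equilibrium and contributes minus its index, as |S| is
even. -/
theorem sum_index [NeZero m] [NeZero n] (hAB : Nondegenerate A B) (hA : ∀ i j, 0 < A i j)
    (hB : ∀ i j, 0 < B i j) :
    ∑ z ∈ (finite_isNash hAB hA hB).toFinset, index A B z.1 z.2 = 1 := by
  have key := sum_coneSign_mixRows 1 (lcpRows A B) (fun _ => 1) (fun _ => 1) one_dotProduct_one_pos
    (lcpRows_dotProduct_one_pos hA hB) (fun S a ha => lcp_nondegenerate hAB S a ha)
  rw [← Finset.add_sum_erase _ _ (Finset.mem_univ ∅)] at key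
  have h0 : coneSign (fun _ => 1) (mixRows 1 (lcpRows A B) ∅) = 1 := by
    have e : mixRows 1 (lcpRows A B) ∅ = 1 := by
      ext i j; simp [mixRows]
    have hc : InCone (fun _ => 1) (1 : Matrix (Fin m ⊕ Fin n) (Fin m ⊕ Fin n) ℝ) :=
      ⟨fun _ => 1, fun _ => one_pos, Matrix.vecMul_one _⟩
    rw [e, coneSign, if_pos hc, Matrix.det_one]
    simp
  rw [Finset.card_empty, pow_zero, one_mul, h0] at key
  have hsum : ∑ S ∈ Finset.univ.erase ∅, (-1) ^ S.card *
      coneSign (fun _ => 1) (mixRows 1 (lcpRows A B) S) =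
      ∑ z ∈ (finite_isNash hAB hA hB).toFinset, -index A B z.1 z.2 := by
    symm
    refine Finset.sum_of_injOn (fun z => (supp z.1).disjSum (supp z.2)) ?_ ?_ ?_ ?_
    · simpa using injOn_supp hAB hA hB
    · intro z hz
      simp only [Set.Finite.coe_toFinset, Set.mem_ofPred_eq] at hz
      obtain ⟨i, hi⟩ := supp_nonempty hz.1
      simp only [Finset.coe_erase, Finset.coe_univ, Set.mem_sdiff, Set.mem_univ, true_and,
        Set.mem_singleton_iff]
      intro h
      have : Sum.inl i ∈ (supp z.1).disjSum (supp z.2) := Finset.inl_mem_disjSum.2 hi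
      rw [h] at this
      simp at this
    · intro S hS hS'
      rw [coneSign, if_neg, mul_zero]
      intro hc
      obtain ⟨x, y, hxy, rfl⟩ := exists_isNash_of_inCone
        (Finset.nonempty_iff_ne_empty.2 (Finset.ne_of_mem_erase hS)) hc
      exact hS' ⟨(x, y), by simpa using hxy, rfl⟩
    · intro z hz
      simp only [Set.Finite.mem_toFinset, Set.mem_ofPred_eq] at hz
      rw [hz.index_eq hAB, coneSign, if_pos (hz.inCone hAB hA hB), Finset.card_disjSum,
        ← hz.card_supp_eq hAB, ← two_mul, pow_mul]
      simp
  rw [hsum, Finset.sum_neg_distrib] at key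
  linarith

theorem index_theorem [NeZero m] [NeZero n] (hAB : Nondegenerate A B) (hA : ∀ i j, 0 < A i j)
    (hB : ∀ i j, 0 < B i j) :
    {z : (Fin m → ℝ) × (Fin n → ℝ) | IsNash A B z.1 z.2 ∧ index A B z.1 z.2 = 1}.ncard =
      {z : (Fin m → ℝ) × (Fin n → ℝ) | IsNash A B z.1 z.2 ∧ index A B z.1 z.2 = -1}.ncard + 1 := by
  classical
  have hcard : ∀ c : ℤ, {z : (Fin m → ℝ) × (Fin n → ℝ) | IsNash A B z.1 z.2 ∧
      index A B z.1 z.2 = c}.ncard =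
      ((finite_isNash hAB hA hB).toFinset.filter fun z => index A B z.1 z.2 = c).card := by
    intro c
    rw [← Set.ncard_coe_finset]
    congr 1
    ext z
    simp
  have hs := sum_index hAB hA hB
  have : ∀ z ∈ (finite_isNash hAB hA hB).toFinset, index A B z.1 z.2 =
      (if index A B z.1 z.2 = 1 then 1 else 0) - (if index A B z.1 z.2 = -1 then 1 else 0) := by
    intro z hz
    simp only [Set.Finite.mem_toFinset, Set.mem_ofPred_eq] at hz
    rcases hz.index_eq_one_or hAB hA hB with h | h <;> simp [h]
  rw [Finset.sum_congr rfl this, Finset.sum_sub_distrib, Finset.sum_boole, Finset.sum_boole] at hs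
  rw [hcard, hcard]
  omega

end Game

/-! ### Expansion of det E(v) and det E(w) by Cramer's rule -/

section VertexDet

variable {m n : ℕ}

theorem neg_one_pow_card_mul_compl {k : ℕ} (S : Finset (Fin k)) :
    (-1 : ℝ) ^ k * (-1) ^ Sᶜ.card = (-1) ^ S.card := by
  have h := Finset.card_add_card_compl S
  rw [Fintype.card_fin] at h
  have h' : (-1 : ℝ) ^ k = (-1) ^ (S.card + Sᶜ.card) := by rw [h]
  rw [h', pow_add, mul_assoc, ← mul_pow]
  simp

theorem coeffP_sum (A : Matrix (Fin m) (Fin n) ℝ) (v : (Fin n → ℝ) × ℝ) (Y : Finset (Fin n))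
    (r : Option (Fin m ⊕ Fin n)) :
    (((listed Y).map some ++ (listed Yᶜ).map some).map
      fun c => (c.elim v.2 v.1 : ℝ) * coeffP A r c).sum = ∑ j, v.1 j * coeffP A r (some j) := by
  rw [List.map_append, List.sum_append, List.map_map, List.map_map, sum_map_listed, sum_map_listed]
  exact Finset.sum_add_sum_compl Y _

/-- The first step of the expansion of `det E(v)`. -/
theorem listDet_coeffP (A : Matrix (Fin m) (Fin n) ℝ) (v : (Fin n → ℝ) × ℝ) (hv : ∑ j, v.1 j = 1)
    (Y : Finset (Fin n)) (R : List (Fin m ⊕ Fin n)) (hR : ∀ k ∈ R, k ∈ labelP A v)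
    (hY : ∀ j ∉ Y, v.1 j = 0) :
    v.2 * listDet (none :: (R.map some ++ (listed Yᶜ).map (fun j => some (Sum.inr j))))
      ((listed Y).map some ++ (listed Yᶜ).map some ++ [none]) (coeffP A) =
      (-1) ^ Y.card * listDet (R.map some) ((listed Y).map some) (coeffP A) := by
  have hlab : ∀ k ∈ labelP A v,
      v.2 * coeffP A (some k) none + ∑ j, v.1 j * coeffP A (some k) (some j) = 0 := by
    rintro (i | j) hk
    · rw [inl_mem_labelP] at hk
      have : ∑ j, v.1 j * coeffP A (some (Sum.inl i)) (some j) = (A *ᵥ v.1) i := by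
        simp [coeffP, Matrix.mulVec, dotProduct, mul_comm]
      rw [this, hk]
      simp [coeffP]
    · rw [inr_mem_labelP] at hk
      simp [coeffP, hk]
  rw [listDet_move_col, List.append_nil, mul_left_comm]
  -- The vector (y, π₁) is annihilated by all rows except the first, ∑ y, where it has the value 1.
  have := listDet_cramer_col (fun c : Option (Fin n) => (c.elim v.2 v.1 : ℝ)) none
    (R.map some ++ (listed Yᶜ).map (fun j => some (Sum.inr j))) none
    ((listed Y).map some ++ (listed Yᶜ).map some) (coeffP A) (fun r hr => ?_)
  · rw [coeffP_sum] at this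
    simp only [Option.elim_none] at this
    rw [this]
    have h1 : v.2 * coeffP A none none + ∑ j, v.1 j * coeffP A none (some j) = 1 := by
      simp [coeffP, hv]
    -- Moving the column π₁ to the front gives (-1)^n and the rows -y_j outside `Y` give (-1)^|Yᶜ|;
    -- together (-1)^|Y|.
    rw [h1, one_mul, listDet_append_diag (-1) _ (nodup_listed _), List.length_append,
      List.length_map, List.length_map, length_listed, length_listed, ← mul_assoc,
      Finset.card_add_card_compl, Fintype.card_fin, neg_one_pow_card_mul_compl]
    · intro j _; simp [coeffP]
    · intro j _ j' _ h; simp [coeffP, h]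
    · intro j hj k hk
      rw [mem_listed, Finset.mem_compl] at hj
      obtain ⟨j', hj', rfl⟩ := List.mem_map.1 hk
      have : j ≠ j' := fun e => hj (e ▸ mem_listed.1 hj')
      simp [coeffP, this]
  · rw [coeffP_sum]
    rcases List.mem_append.1 hr with hr | hr
    · obtain ⟨k, hk, rfl⟩ := List.mem_map.1 hr
      exact hlab k (hR k hk)
    · obtain ⟨j, hj, rfl⟩ := List.mem_map.1 hr
      rw [mem_listed, Finset.mem_compl] at hj
      exact hlab _ (inr_mem_labelP.2 (hY j hj))

theorem listDet_coeffP_inl (A : Matrix (Fin m) (Fin n) ℝ) (I : Finset (Fin m))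
    (J : List (Fin n)) :
    listDet ((listed I).map fun i => some (Sum.inl i)) (J.map some) (coeffP A) =
      listDet (listed I) J A := by
  rw [listDet_map]
  rfl

/-- The case of a duplicate column label: its row -y_j has a single nonzero entry among these
columns, and the signs are those of its row and column positions. -/
theorem listDet_coeffP_inr (A : Matrix (Fin m) (Fin n) ℝ) (I : Finset (Fin m)) (j : Fin n)
    (L₁ L₂ : List (Fin n)) (hL : (L₁ ++ j :: L₂).Nodup) :
    listDet (((listed I).map Sum.inl ++ [Sum.inr j]).map some) ((L₁ ++ j :: L₂).map some)
      (coeffP A) = -((-1) ^ I.card * (-1) ^ L₁.length * listDet (listed I) (L₁ ++ L₂) A) := by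
  rw [List.nodup_middle, List.nodup_cons] at hL
  rw [List.map_append, List.map_append, List.map_cons, List.map_cons, listDet_move,
    listDet_move_col, listDet_cons, ← List.map_append (l₁ := L₁), List.map_nil, List.append_nil,
    List.map_map]
  · have e : listDet ((listed I).map (some ∘ Sum.inl)) ((L₁ ++ L₂).map some) (coeffP A) =
        listDet (listed I) (L₁ ++ L₂) A := listDet_coeffP_inl A I _
    rw [e]
    simp [coeffP, length_listed]
    ring
  · intro k hk
    rw [← List.map_append] at hk
    obtain ⟨j', hj', rfl⟩ := List.mem_map.1 hk
    have : j ≠ j' := fun e => hL.1 (e ▸ hj')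
    simp [coeffP, this]

/-- The values of the variables of `Q'` at a point. -/
def varVal (w : (Fin m → ℝ) × ℝ × ℝ) : VarQ' m → ℝ
  | VarQ'.lam => w.2.1
  | VarQ'.x i => w.1 i
  | VarQ'.pi => w.2.2

theorem coeffQ'_sum (B : Matrix (Fin m) (Fin n) ℝ) (β : Fin n → ℝ) (w : (Fin m → ℝ) × ℝ × ℝ)
    (X : Finset (Fin m)) (k : Option (Fin m ⊕ Fin n)) :
    (((listed X).map VarQ'.x ++ (listed Xᶜ).map VarQ'.x).map
      fun r => varVal w r * coeffQ' B β r k).sum = ∑ i, w.1 i * coeffQ' B β (VarQ'.x i) k := by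
  rw [List.map_append, List.sum_append, List.map_map, List.map_map, sum_map_listed, sum_map_listed]
  exact Finset.sum_add_sum_compl X _

theorem coeffQ'_comb_inl (B : Matrix (Fin m) (Fin n) ℝ) (β : Fin n → ℝ)
    (x : Fin m → ℝ) (i : Fin m) :
    ∑ i', x i' * coeffQ' B β (VarQ'.x i') (some (Sum.inl i)) = -x i := by
  simp [coeffQ']

theorem coeffQ'_comb_inr (B : Matrix (Fin m) (Fin n) ℝ) (β : Fin n → ℝ)
    (x : Fin m → ℝ) (j : Fin n) :
    ∑ i, x i * coeffQ' B β (VarQ'.x i) (some (Sum.inr j)) = (x ᵥ* B) j := by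
  simp [coeffQ', Matrix.vecMul, dotProduct]

/-- Substituting `λ + ∑ α_i x_i` for `λ` turns `C` into `C + α βᵀ`. -/
theorem listDet_coeffQ'_add (C : Matrix (Fin m) (Fin n) ℝ) (α : Fin m → ℝ) (β : Fin n → ℝ)
    (R : List (VarQ' m)) (hR : VarQ'.lam ∉ R) (K : List (Option (Fin m ⊕ Fin n))) :
    listDet (VarQ'.lam :: R) K (coeffQ' (C + Matrix.vecMulVec α β) β) =
      listDet (VarQ'.lam :: R) K (coeffQ' C β) := by
  refine listDet_row_op (fun r => match r with | VarQ'.x i => α i | _ => 0) ?_ ?_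
  · rintro (_ | i | j) _ <;> rfl
  · rintro (_ | i | _) hr (_ | i' | j) _
    all_goals first
      | exact absurd hr hR
      | simp [coeffQ', Matrix.vecMulVec_apply]

/-- The first step of the expansion of `det E(w)`. -/
theorem listDet_coeffQ'_lam (B : Matrix (Fin m) (Fin n) ℝ) (β : Fin n → ℝ)
    (w : (Fin m → ℝ) × ℝ × ℝ) (hw : ∑ i, w.1 i = 1) (X : Finset (Fin m))
    (K : List (Fin m ⊕ Fin n)) (hK : ∀ k ∈ K, k ∈ labelQ' B β w) :
    w.2.1 * listDet (VarQ'.lam :: ((listed X).map VarQ'.x ++ (listed Xᶜ).map VarQ'.x ++ [VarQ'.pi]))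
      (none :: K.map some) (coeffQ' B β) =
      (-1) ^ m * listDet (VarQ'.pi :: ((listed X).map VarQ'.x ++ (listed Xᶜ).map VarQ'.x))
        (K.map some) (coeffQ' B β) := by
  -- The combination of the rows with weights (λ, x, π₂) vanishes on all tight columns and is 1 on ∑
  -- x. Moving the row π₂ past the m rows x_i gives (-1)^m.
  have := listDet_cramer (varVal w) VarQ'.lam
    ((listed X).map VarQ'.x ++ (listed Xᶜ).map VarQ'.x ++ [VarQ'.pi]) none (K.map some)
    (coeffQ' B β) (fun k hk => ?_)
  · rw [List.map_append, List.sum_append, coeffQ'_sum] at this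
    have h1 : varVal w VarQ'.lam = w.2.1 := rfl
    rw [h1] at this
    rw [this, listDet_move, List.append_nil, List.length_append, List.length_map, List.length_map,
      length_listed, length_listed, Finset.card_add_card_compl, Fintype.card_fin]
    simp [coeffQ', hw]
  · obtain ⟨k, hk, rfl⟩ := List.mem_map.1 hk
    replace hk := hK _ (by simpa using hk)
    rw [List.map_append, List.sum_append, coeffQ'_sum]
    rcases k with i | j
    · rw [coeffQ'_comb_inl]
      have : w.1 i = 0 := by simpa [labelQ'] using hk
      simp [coeffQ', this]
    · rw [coeffQ'_comb_inr]
      have : (w.1 ᵥ* B) j + β j * w.2.1 = w.2.2 := by simpa [labelQ'] using hk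
      simp only [varVal, coeffQ', List.map_cons, List.map_nil, List.sum_cons, List.sum_nil]
      linarith

/-- The second step of the expansion of `det E(w)`: all columns but `k` are tight at `(x, π)`. -/
theorem listDet_coeffQ'_pi (B : Matrix (Fin m) (Fin n) ℝ) (β : Fin n → ℝ)
    (x : Fin m → ℝ) (π : ℝ) (X : Finset (Fin m)) (hX : ∀ i ∉ X, x i = 0) (k : Fin m ⊕ Fin n)
    (J : List (Fin n)) (hJ : ∀ j ∈ J, (x ᵥ* B) j = π) :
    π * listDet (VarQ'.pi :: ((listed X).map VarQ'.x ++ (listed Xᶜ).map VarQ'.x))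
      (some k :: (J.map (fun j => some (Sum.inr j)) ++ (listed Xᶜ).map (fun i => some (Sum.inl i))))
      (coeffQ' B β) =
      (Sum.elim (fun i => -x i) (fun j => (x ᵥ* B) j - π) k) *
        ((-1) ^ Xᶜ.card * listDet (listed X) J B) := by
  have hval : ∀ k, varVal (x, 0, π) VarQ'.pi * coeffQ' B β VarQ'.pi (some k) +
      ∑ i, x i * coeffQ' B β (VarQ'.x i) (some k) =
      Sum.elim (fun i => -x i) (fun j => (x ᵥ* B) j - π) k := by
    rintro (i | j)
    · rw [coeffQ'_comb_inl]; simp [coeffQ']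
    · rw [coeffQ'_comb_inr]
      simp only [varVal, coeffQ', Sum.elim_inr]
      ring
  have := listDet_cramer (varVal (x, 0, π)) VarQ'.pi
    ((listed X).map VarQ'.x ++ (listed Xᶜ).map VarQ'.x) (some k)
    (J.map (fun j => some (Sum.inr j)) ++ (listed Xᶜ).map (fun i => some (Sum.inl i)))
    (coeffQ' B β) (fun k hk => ?_)
  · rw [coeffQ'_sum, hval] at this
    have h1 : varVal ((x, 0, π) : (Fin m → ℝ) × ℝ × ℝ) VarQ'.pi = π := rfl
    rw [h1] at this
    rw [this, listDet_append_diag_col (-1) _ (nodup_listed _), length_listed, listDet_map]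
    · rfl
    · intro i _; simp [coeffQ']
    · intro i _ i' _ h; simp [coeffQ', h]
    · intro i hi r hr
      rw [mem_listed, Finset.mem_compl] at hi
      obtain ⟨i', hi', rfl⟩ := List.mem_map.1 hr
      have : i' ≠ i := fun e => hi (e ▸ mem_listed.1 hi')
      simp [coeffQ', this]
  · rw [coeffQ'_sum]
    rcases List.mem_append.1 hk with hk | hk
    · obtain ⟨j, hj, rfl⟩ := List.mem_map.1 hk
      rw [hval]
      simp [hJ j hj]
    · obtain ⟨i, hi, rfl⟩ := List.mem_map.1 hk
      rw [mem_listed, Finset.mem_compl] at hi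
      rw [hval]
      simp [hX i hi]

end VertexDet

/-! ### The sign of a vertex and its side of H -/

section VertexSign

variable {m n : ℕ} {A C : Matrix (Fin m) (Fin n) ℝ} {β : Fin n → ℝ} {α : Fin m → ℝ}

theorem inl_mem_labelQ' {w : (Fin m → ℝ) × ℝ × ℝ} {i : Fin m} :
    Sum.inl i ∈ labelQ' C β w ↔ w.1 i = 0 := by simp [labelQ']

theorem inr_mem_labelQ' {w : (Fin m → ℝ) × ℝ × ℝ} {j : Fin n} :
    Sum.inr j ∈ labelQ' C β w ↔ (w.1 ᵥ* C) j + β j * w.2.1 = w.2.2 := by simp [labelQ']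

theorem vecMul_add_vecMulVec (x : Fin m → ℝ) (j : Fin n) :
    (x ᵥ* (C + Matrix.vecMulVec α β)) j = (x ᵥ* C) j + β j * ∑ i, α i * x i := by
  rw [Matrix.vecMul_add, Pi.add_apply, Matrix.vecMul_vecMulVec, Pi.smul_apply]
  simp only [dotProduct, smul_eq_mul]
  rw [mul_comm]
  simp only [mul_comm]

/-- In the coordinate λ - ∑ α_i x_i the matrix C becomes C + αβᵀ and H becomes the zero set of that
coordinate. -/
theorem labelQ'_shift (w : (Fin m → ℝ) × ℝ × ℝ) :
    labelQ' (C + Matrix.vecMulVec α β) β (w.1, w.2.1 - ∑ i, α i * w.1 i, w.2.2) =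
      labelQ' C β w := by
  ext (i | j)
  · simp only [inl_mem_labelQ']
  · simp only [inr_mem_labelQ', vecMul_add_vecMulVec]
    rw [mul_sub, add_add_sub_cancel]

theorem detEv_eq {u : Pt m n} (hu : u ∈ N A C β) :
    u.1.2 * detEv A C β u = (-1) ^ (setY C β u).card *
      listDet (((listed (setX A u)).map Sum.inl ++ (listed (dupY A C β u)).map Sum.inr).map some)
        ((listed (setY C β u)).map some) (coeffP A) := by
  rw [← listDet_coeffP A u.1 hu.1.1.2.2]
  · simp [detEv, List.map_append, List.map_map, Function.comp_def]
  · intro k hk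
    rcases List.mem_append.1 hk with hk | hk
    · obtain ⟨i, hi, rfl⟩ := List.mem_map.1 hk
      rw [mem_listed] at hi
      simpa [setX] using hi
    · obtain ⟨j, hj, rfl⟩ := List.mem_map.1 hk
      rw [mem_listed] at hj
      exact (by simpa [dupY] using hj : _ ∧ _).1
  · intro j hj
    have : Sum.inr j ∈ labelP A u.1 ∪ labelQ' C β u.2 := hu.2 ▸ Finset.mem_univ _
    rw [Finset.mem_union] at this
    exact inr_mem_labelP.1 (this.resolve_right (by simpa [setY] using hj))

/-- Cramer's rule in the shifted coordinate, so that the factor is the value at `u` of the form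
defining H; the shift is a row operation and leaves the determinant unchanged. -/
theorem detEw_eq (α : Fin m → ℝ) {u : Pt m n} (hu : u ∈ N A C β) :
    hyper α u * detEw A C β u = (-1) ^ m *
      listDet (VarQ'.pi :: ((listed (setX A u)).map VarQ'.x ++ (listed (setX A u)ᶜ).map VarQ'.x))
        (((listed (setY C β u)).map Sum.inr ++ (listed (dupX A C β u)).map Sum.inl ++
          (listed (setX A u)ᶜ).map Sum.inl).map some) (coeffQ' (C + Matrix.vecMulVec α β) β) := by
  have key := listDet_coeffQ'_lam (C + Matrix.vecMulVec α β) β (u.2.1, hyper α u, u.2.2.2)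
    hu.1.2.2.2 (setX A u) ((listed (setY C β u)).map Sum.inr ++
      (listed (dupX A C β u)).map Sum.inl ++ (listed (setX A u)ᶜ).map Sum.inl) (fun k hk => ?_)
  · rw [← key, listDet_coeffQ'_add]
    · simp [detEw, List.map_append, List.map_map, Function.comp_def]
    · simp
  · have hs : labelQ' (C + Matrix.vecMulVec α β) β (u.2.1, hyper α u, u.2.2.2) = labelQ' C β u.2 :=
      labelQ'_shift u.2
    rw [hs]
    rcases List.mem_append.1 hk with hk | hk
    · rcases List.mem_append.1 hk with hk | hk
      · obtain ⟨j, hj, rfl⟩ := List.mem_map.1 hk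
        rw [mem_listed] at hj
        simpa [setY] using hj
      · obtain ⟨i, hi, rfl⟩ := List.mem_map.1 hk
        rw [mem_listed] at hi
        exact (by simpa [dupX] using hi : _ ∧ _).2
    · obtain ⟨i, hi, rfl⟩ := List.mem_map.1 hk
      rw [mem_listed, Finset.mem_compl] at hi
      have : Sum.inl i ∈ labelP A u.1 ∪ labelQ' C β u.2 := hu.2 ▸ Finset.mem_univ _
      rw [Finset.mem_union] at this
      exact this.resolve_left (by simpa [setX] using hi)

/-- The determinants at a vertex `u` whose labels are those of a fully labeled point with first
strategy `x` on the hyperplane, and one more label `k`. -/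
theorem det_vertex_mul_hyper {u : Pt m n} (hu : u ∈ N A C β) {x : Fin m → ℝ} {π₂ : ℝ}
    {I : Finset (Fin m)} {J : Finset (Fin n)} (hIJ : I.card = J.card) {k : Fin m ⊕ Fin n}
    (hx : ∀ i ∉ I, x i = 0) (hxJ : ∀ j ∈ J, (x ᵥ* (C + Matrix.vecMulVec α β)) j = π₂)
    (hP : labelP A u.1 = I.disjSum Jᶜ) (hQ : labelQ' C β u.2 = insert k (Iᶜ.disjSum J))
    (hk : k ∈ labelP A u.1) :
    u.1.2 * π₂ * (detEv A C β u * detEw A C β u * hyper α u) =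
      Sum.elim (fun i => -x i) (fun j => (x ᵥ* (C + Matrix.vecMulVec α β)) j - π₂) k *
        ((-1) ^ I.card * (listDet (listed I) (listed J) A *
          listDet (listed I) (listed J) (C + Matrix.vecMulVec α β))) := by
  have hX : setX A u = I := by
    ext i; simp [setX, hP]
  have hv := detEv_eq hu
  have hw := detEw_eq α hu
  have hsq : ∀ p : ℕ, (-1 : ℝ) ^ p * (-1) ^ p = 1 := fun p => by rw [← mul_pow]; simp
  have hmI : (-1 : ℝ) ^ m * (-1) ^ Iᶜ.card = (-1) ^ I.card := neg_one_pow_card_mul_compl I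
  rcases k with i | j
  · have hi : i ∈ I := by simpa [hP] using hk
    have hY : setY C β u = J := by
      ext j; simp [setY, hQ]
    have hdX : dupX A C β u = {i} := by
      ext i'
      simp only [dupX, Finset.mem_inter, hP, hQ, Finset.mem_filter, Finset.mem_univ, true_and,
        Finset.inl_mem_disjSum, Finset.mem_insert, Sum.inl.injEq, Finset.mem_compl,
        Finset.mem_singleton]
      constructor
      · rintro ⟨h1, h2 | h2⟩
        · exact h2
        · exact absurd h1 h2
      · rintro rfl
        exact ⟨hi, Or.inl rfl⟩
    have hdY : dupY A C β u = ∅ := by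
      ext j
      simp [dupY, hP, hQ]
    rw [hX, hY, hdY, listed_empty, List.map_nil, List.append_nil, List.map_map] at hv
    have e := listDet_coeffP_inl A I (listed J)
    rw [show listDet ((listed I).map (some ∘ Sum.inl)) ((listed J).map some) (coeffP A) =
      listDet (listed I) (listed J) A from e] at hv
    rw [hX, hY, hdX, listed_singleton, List.map_append, List.map_append, List.map_cons, List.map_nil,
      List.map_cons, List.map_nil, List.append_assoc, List.singleton_append, listDet_move_col,
      List.map_map, List.map_map, List.length_map, length_listed] at hw
    have e2 := listDet_coeffQ'_pi (C + Matrix.vecMulVec α β) β x π₂ I hx (Sum.inl i) (listed J)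
      (fun j hj => hxJ j (mem_listed.1 hj))
    simp only [Function.comp_def] at hw
    -- The factors π₁ and `hyper α u` come from Cramer's rule at `u`, the factor π₂ from Cramer's
    -- rule at the equilibrium (x, π₂), where only the column of the extra label is not tight.
    calc u.1.2 * π₂ * (detEv A C β u * detEw A C β u * hyper α u)
        = (u.1.2 * detEv A C β u) * (π₂ * (hyper α u * detEw A C β u)) := by ring
      _ = _ := by
        rw [hv, hw, mul_left_comm π₂, mul_left_comm π₂, e2, ← hIJ]
        have h4 : (-1 : ℝ) ^ I.card * (-1) ^ I.card * ((-1) ^ m * (-1) ^ Iᶜ.card) =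
            (-1) ^ I.card := by rw [hsq, hmI]; ring
        linear_combination (Sum.elim (fun i => -x i)
          (fun j => (x ᵥ* (C + Matrix.vecMulVec α β)) j - π₂) (Sum.inl i) *
          (listDet (listed I) (listed J) A *
          listDet (listed I) (listed J) (C + Matrix.vecMulVec α β))) * h4
  · have hj : j ∉ J := by simpa [hP] using hk
    have hY : setY C β u = insert j J := by
      ext j'; simp [setY, hQ]
    have hdY : dupY A C β u = {j} := by
      ext j'
      simp only [dupY, Finset.mem_inter, hP, hQ, Finset.mem_filter, Finset.mem_univ, true_and,
        Finset.inr_mem_disjSum, Finset.mem_insert, Sum.inr.injEq, Finset.mem_compl,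
        Finset.mem_singleton]
      constructor
      · rintro ⟨h1, h2 | h2⟩
        · exact h2
        · exact absurd h2 h1
      · rintro rfl
        exact ⟨hj, Or.inl rfl⟩
    have hdX : dupX A C β u = ∅ := by
      ext i
      simp [dupX, hP, hQ]
    obtain ⟨L₁, L₂, hL, hL'⟩ := listed_insert hj
    have hnd := nodup_listed (insert j J)
    rw [hX, hY, hdY, listed_singleton, List.map_cons, List.map_nil, hL,
      listDet_coeffP_inr A I j L₁ L₂ (hL ▸ hnd), ← hL', Finset.card_insert_of_notMem hj] at hv
    have hlist : ((L₁ ++ j :: L₂).map Sum.inr ++ (listed Iᶜ).map Sum.inl).map some =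
        L₁.map (fun j => some (Sum.inr j)) ++ some (Sum.inr j) ::
          (L₂.map (fun j => some (Sum.inr j)) ++
            (listed Iᶜ).map fun i => some (Sum.inl i : Fin m ⊕ Fin n)) := by
      simp [Function.comp_def]
    rw [hX, hY, hdX, listed_empty, List.map_nil, List.append_nil, hL, hlist, listDet_move_col,
      ← List.append_assoc (L₁.map _), ← List.map_append (l₁ := L₁), ← hL', List.length_map] at hw
    have e2 := listDet_coeffQ'_pi (C + Matrix.vecMulVec α β) β x π₂ I hx (Sum.inr j) (listed J)
      (fun j hj => hxJ j (mem_listed.1 hj))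
    calc u.1.2 * π₂ * (detEv A C β u * detEw A C β u * hyper α u)
        = (u.1.2 * detEv A C β u) * (π₂ * (hyper α u * detEw A C β u)) := by ring
      _ = _ := by
        rw [hv, hw, mul_left_comm π₂, mul_left_comm π₂, e2, ← hIJ, pow_succ]
        -- The position of `j` in `Y` enters once through E(v) and once through E(w), and cancels.
        have h4 : (-1 : ℝ) ^ I.card * (-1) ^ I.card * ((-1) ^ L₁.length * (-1) ^ L₁.length) *
            ((-1) ^ m * (-1) ^ Iᶜ.card) = (-1) ^ I.card := by rw [hsq, hsq, hmI]; ring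
        linear_combination (Sum.elim (fun i => -x i)
          (fun j => (x ᵥ* (C + Matrix.vecMulVec α β)) j - π₂) (Sum.inr j) *
          (listDet (listed I) (listed J) A *
          listDet (listed I) (listed J) (C + Matrix.vecMulVec α β))) * h4

end VertexSign

/-! ### Slacks, faces and extension of segments -/

section Edge

variable {m n : ℕ} {A C : Matrix (Fin m) (Fin n) ℝ} {β : Fin n → ℝ} {α : Fin m → ℝ}

/-! ### Slacks -/

/-- The slacks of the inequalities of `P`. -/
def slackP (A : Matrix (Fin m) (Fin n) ℝ) (v : (Fin n → ℝ) × ℝ) : Fin m ⊕ Fin n → ℝ :=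
  Sum.elim (fun i => v.2 - (A *ᵥ v.1) i) v.1

/-- The slacks of the inequalities of `Q'`. -/
def slackQ' (C : Matrix (Fin m) (Fin n) ℝ) (β : Fin n → ℝ) (w : (Fin m → ℝ) × ℝ × ℝ) :
    Fin m ⊕ Fin n → ℝ :=
  Sum.elim w.1 (fun j => w.2.2 - ((w.1 ᵥ* C) j + β j * w.2.1))

theorem mem_P_iff {v : (Fin n → ℝ) × ℝ} :
    v ∈ P A ↔ (∀ k, 0 ≤ slackP A v k) ∧ ∑ j, v.1 j = 1 := by
  simp [P, slackP, and_assoc]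

theorem mem_Q'_iff {w : (Fin m → ℝ) × ℝ × ℝ} :
    w ∈ Q' C β ↔ (∀ k, 0 ≤ slackQ' C β w k) ∧ ∑ i, w.1 i = 1 := by
  simp [Q', slackQ', and_assoc]

theorem mem_labelP_iff {v : (Fin n → ℝ) × ℝ} {k : Fin m ⊕ Fin n} :
    k ∈ labelP A v ↔ slackP A v k = 0 := by
  rcases k with i | j
  · rw [inl_mem_labelP, slackP, Sum.elim_inl, sub_eq_zero, eq_comm]
  · rw [inr_mem_labelP, slackP, Sum.elim_inr]

theorem mem_labelQ'_iff {w : (Fin m → ℝ) × ℝ × ℝ} {k : Fin m ⊕ Fin n} :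
    k ∈ labelQ' C β w ↔ slackQ' C β w k = 0 := by
  rcases k with i | j
  · rw [inl_mem_labelQ', slackQ', Sum.elim_inl]
  · rw [inr_mem_labelQ', slackQ', Sum.elim_inr, sub_eq_zero, eq_comm]

theorem slackP_comb (a b : ℝ) (v v' : (Fin n → ℝ) × ℝ) (k : Fin m ⊕ Fin n) :
    slackP A (a • v + b • v') k = a * slackP A v k + b * slackP A v' k := by
  rcases k with i | j
  · simp only [slackP, Sum.elim_inl, Prod.fst_add, Prod.snd_add, Prod.smul_fst, Prod.smul_snd,
      Matrix.mulVec_add, Matrix.mulVec_smul, Pi.add_apply, Pi.smul_apply, smul_eq_mul]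
    ring
  · simp [slackP]

theorem slackQ'_comb (a b : ℝ) (w w' : (Fin m → ℝ) × ℝ × ℝ) (k : Fin m ⊕ Fin n) :
    slackQ' C β (a • w + b • w') k = a * slackQ' C β w k + b * slackQ' C β w' k := by
  rcases k with i | j
  · simp [slackQ']
  · simp only [slackQ', Sum.elim_inr, Prod.fst_add, Prod.snd_add, Prod.smul_fst, Prod.smul_snd,
      Matrix.add_vecMul, Matrix.smul_vecMul, Pi.add_apply, Pi.smul_apply, smul_eq_mul]
    ring

theorem sum_comb {k : ℕ} {a b : ℝ} (hab : a + b = 1) {x x' : Fin k → ℝ} (hx : ∑ i, x i = 1)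
    (hx' : ∑ i, x' i = 1) : ∑ i, (a • x + b • x') i = 1 := by
  simp only [Pi.add_apply, Pi.smul_apply, smul_eq_mul]
  rw [Finset.sum_add_distrib, ← Finset.mul_sum, ← Finset.mul_sum, hx, hx']
  linarith

theorem hyper_comb (a b : ℝ) (p q : Pt m n) :
    hyper α (a • p + b • q) = a * hyper α p + b * hyper α q := by
  simp only [hyper, Prod.fst_add, Prod.snd_add, Prod.smul_fst, Prod.smul_snd, Pi.add_apply,
    Pi.smul_apply, smul_eq_mul, mul_add, Finset.sum_add_distrib, mul_sub, Finset.mul_sum]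
  have h : ∀ (c : ℝ) (x : Fin m → ℝ), ∑ i, α i * (c * x i) = ∑ i, c * (α i * x i) := fun c x =>
    Finset.sum_congr rfl fun i _ => by ring
  rw [h, h]
  ring

theorem comb_mem {a b : ℝ} (hab : a + b = 1) {p q : Pt m n} (hp : p ∈ P A ×ˢ Q' C β)
    (hq : q ∈ P A ×ˢ Q' C β) (h1 : ∀ k, 0 ≤ a * slackP A p.1 k + b * slackP A q.1 k)
    (h2 : ∀ k, 0 ≤ a * slackQ' C β p.2 k + b * slackQ' C β q.2 k) :
    a • p + b • q ∈ P A ×ˢ Q' C β := by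
  refine ⟨mem_P_iff.2 ⟨fun k => ?_, ?_⟩, mem_Q'_iff.2 ⟨fun k => ?_, ?_⟩⟩
  · exact (h1 k).trans_eq (slackP_comb a b p.1 q.1 k).symm
  · exact sum_comb hab hp.1.2.2 hq.1.2.2
  · exact (h2 k).trans_eq (slackQ'_comb a b p.2 q.2 k).symm
  · exact sum_comb hab hp.2.2.2 hq.2.2.2

theorem eventually_extend {κ : Type*} [Finite κ] {f g : κ → ℝ} (hf : ∀ k, 0 ≤ f k)
    (hfg : ∀ k, f k = 0 → g k = 0) :
    ∀ᶠ ε in nhdsWithin (0 : ℝ) (Set.Ioi 0), ∀ k, 0 ≤ (1 + ε) * f k + (-ε) * g k := by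
  rw [Filter.eventually_all]
  intro k
  rcases (hf k).eq_or_lt with h | h
  · exact Filter.Eventually.of_forall fun ε => by rw [← h, hfg k h.symm]; simp
  · have hc : Filter.Tendsto (fun ε : ℝ => (1 + ε) * f k + (-ε) * g k)
        (nhdsWithin (0 : ℝ) (Set.Ioi 0)) (nhds (f k)) := by
      have : Continuous fun ε : ℝ => (1 + ε) * f k + (-ε) * g k := by fun_prop
      have := this.tendsto 0
      simp only [add_zero, one_mul, neg_zero, zero_mul] at this
      exact this.mono_left nhdsWithin_le_nhds
    exact (hc.eventually (lt_mem_nhds h)).mono fun ε h => h.le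

/-- If all constraints that are tight at `r` are tight at `p`, then the segment from `p` to `r` can be
extended beyond `r`. -/
theorem exists_extend {p r : Pt m n} (hr : r ∈ P A ×ˢ Q' C β) (hp : p ∈ P A ×ˢ Q' C β)
    (h1 : labelP A r.1 ⊆ labelP A p.1) (h2 : labelQ' C β r.2 ⊆ labelQ' C β p.2) :
    ∃ ε : ℝ, 0 < ε ∧ (1 + ε) • r + (-ε) • p ∈ P A ×ˢ Q' C β := by
  have e1 := eventually_extend (mem_P_iff.1 hr.1).1
    (fun k hk => mem_labelP_iff.1 (h1 (mem_labelP_iff.2 hk)))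
  have e2 := eventually_extend (mem_Q'_iff.1 hr.2).1
    (fun k hk => mem_labelQ'_iff.1 (h2 (mem_labelQ'_iff.2 hk)))
  obtain ⟨ε, ⟨h1, h2⟩, hε⟩ := ((e1.and e2).and self_mem_nhdsWithin).exists
  exact ⟨ε, hε, comb_mem (by ring) hr hp h1 h2⟩

theorem eq_of_extreme {u r : Pt m n} (hu : u ∈ Set.extremePoints ℝ (P A ×ˢ Q' C β))
    (hr : r ∈ P A ×ˢ Q' C β) (h1 : labelP A u.1 ⊆ labelP A r.1)
    (h2 : labelQ' C β u.2 ⊆ labelQ' C β r.2) : r = u := by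
  obtain ⟨ε, hε, hq⟩ := exists_extend hu.1 hr h1 h2
  -- `u` is the convex combination of `r` and (1 + ε)u - εr with these weights, hence interior to a
  -- segment of the polyhedron.
  refine hu.2 hr hq ⟨ε / (1 + ε), 1 / (1 + ε), by positivity, by positivity, ?_, ?_⟩
  · field_simp; ring
  · have h0 : (1 + ε) ≠ 0 := by positivity
    rw [smul_add, smul_smul, smul_smul, div_mul_cancel₀ _ h0, one_smul, add_left_comm, ← add_smul]
    have : ε / (1 + ε) + 1 / (1 + ε) * -ε = 0 := by field_simp; ring
    rw [this, zero_smul, add_zero]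

/-- The exposing functional is constant on the face, hence has the same value at every affine
combination. The weights may be negative, which permits moving beyond the end points of a segment.
-/
theorem IsExposed.mem_of_comb {E : Type*} [AddCommGroup E] [Module ℝ E] [TopologicalSpace E]
    {S F : Set E} (hF : IsExposed ℝ S F) {p q : E} (hp : p ∈ F) (hq : q ∈ F) {a b : ℝ}
    (hab : a + b = 1) (h : a • p + b • q ∈ S) : a • p + b • q ∈ F := by
  obtain ⟨l, rfl⟩ := hF ⟨p, hp⟩
  refine ⟨h, fun y hy => ?_⟩
  have e : l p = l q := le_antisymm (hq.2 p hp.1) (hp.2 q hq.1)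
  rw [map_add, map_smul, map_smul, ← e, smul_eq_mul, smul_eq_mul, ← add_mul, hab, one_mul]
  exact hp.2 y hy

theorem mem_Q_of_hyper {x : Fin m → ℝ} {l π₂ : ℝ} (hl : l = ∑ i, α i * x i)
    (h : (x, l, π₂) ∈ Q' C β) : (x, π₂) ∈ Q (C + Matrix.vecMulVec α β) := by
  refine ⟨h.1, fun j => ?_, h.2.2⟩
  rw [vecMul_add_vecMulVec, ← hl]
  exact h.2.1 j

theorem labelQ_of_hyper {x : Fin m → ℝ} {l π₂ : ℝ} (hl : l = ∑ i, α i * x i) :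
    labelQ (C + Matrix.vecMulVec α β) (x, π₂) = labelQ' C β (x, l, π₂) := by
  ext (i | j)
  · rw [inl_mem_labelQ, inl_mem_labelQ']
  · rw [inr_mem_labelQ, inr_mem_labelQ', vecMul_add_vecMulVec, ← hl]

/-- A fully labeled pair of a nondegenerate game has no duplicate label. -/
theorem disjoint_labels {B : Matrix (Fin m) (Fin n) ℝ} (hAB : Nondegenerate A B)
    {v : (Fin n → ℝ) × ℝ} {w : (Fin m → ℝ) × ℝ} (hv : v ∈ P A) (hw : w ∈ Q B)
    (h : labelP A v ∪ labelQ B w = Finset.univ) : Disjoint (labelP A v) (labelQ B w) := by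
  rw [Finset.disjoint_iff_inter_eq_empty, ← Finset.card_eq_zero]
  have c1 := hAB.1 v hv
  have c2 := hAB.2 w hw
  have c3 := Finset.card_union_add_card_inter (labelP A v) (labelQ B w)
  rw [h, Finset.card_univ, Fintype.card_sum, Fintype.card_fin, Fintype.card_fin] at c3
  omega

/-! ### The crossing of an edge with H -/

section Crossing

variable (hQ' : NondegQ' C β) (hG : Nondegenerate A (C + Matrix.vecMulVec α β))
  (hA : ∀ i j, 0 < A i j) (hB : ∀ i j, 0 < (C + Matrix.vecMulVec α β) i j)
  {F : Set (Pt m n)} (hF : IsEdgeN A C β F) {y : Fin n → ℝ} {π₁ : ℝ} {x : Fin m → ℝ} {l π₂ : ℝ}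
  (hr : ((y, π₁), (x, l, π₂)) ∈ F) (hl : l = ∑ i, α i * x i)

include hF hr hl

theorem isNash_of_mem_edge : IsNash A (C + Matrix.vecMulVec α β) x y := by
  have h := hF.1 hr
  exact isNash_of_labels h.1.1 (mem_Q_of_hyper hl h.1.2) (by rw [labelQ_of_hyper hl]; exact h.2)

include hG

theorem disjoint_labels_of_mem_edge :
    Disjoint (labelP A (y, π₁)) (labelQ' C β (x, l, π₂)) := by
  have h := hF.1 hr
  rw [← labelQ_of_hyper hl]
  exact disjoint_labels hG h.1.1 (mem_Q_of_hyper hl h.1.2) (by rw [labelQ_of_hyper hl]; exact h.2)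

/-- The labels of a point of the edge on the hyperplane are labels of all points of the edge. -/
theorem labels_subset_of_mem_edge {p : Pt m n} (hp : p ∈ F) :
    labelP A (y, π₁) = labelP A (((1 / 2 : ℝ) • p + (1 / 2 : ℝ) • ((y, π₁), (x, l, π₂)) : Pt m n)).1 ∧
      labelP A (y, π₁) ⊆ labelP A p.1 ∧ labelQ' C β (x, l, π₂) ⊆ labelQ' C β p.2 := by
  have hrN := hF.1 hr
  have hpN := hF.1 hp
  have hdis := disjoint_labels_of_mem_edge hG hF hr hl
  set r : Pt m n := ((y, π₁), (x, l, π₂)) with hrdef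
  have sP := (mem_P_iff.1 hrN.1.1).1
  have sQ := (mem_Q'_iff.1 hrN.1.2).1
  have tP := (mem_P_iff.1 hpN.1.1).1
  have tQ := (mem_Q'_iff.1 hpN.1.2).1
  -- The midpoint lies in the edge, so it is fully labeled, yet it has only labels common to `p` and
  -- `r`. As the label sets of `r` are disjoint, the midpoint must have every label of `r`.
  have hs : (1 / 2 : ℝ) • p + (1 / 2 : ℝ) • r ∈ F := by
    refine IsExposed.mem_of_comb hF.2.1 hp hr (by norm_num)
      (comb_mem (by norm_num) hpN.1 hrN.1 (fun k => ?_) (fun k => ?_))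
    · have := sP k; have := tP k; positivity
    · have := sQ k; have := tQ k; positivity
  have hsN := hF.1 hs
  have hP : ∀ k ∈ labelP A ((1 / 2 : ℝ) • p + (1 / 2 : ℝ) • r).1,
      k ∈ labelP A p.1 ∧ k ∈ labelP A r.1 := by
    intro k hk
    rw [mem_labelP_iff] at hk
    have e := (slackP_comb (A := A) (1 / 2) (1 / 2) p.1 r.1 k).symm.trans hk
    have := sP k
    have := tP k
    rw [mem_labelP_iff, mem_labelP_iff]
    constructor <;> linarith
  have hQ : ∀ k ∈ labelQ' C β ((1 / 2 : ℝ) • p + (1 / 2 : ℝ) • r).2,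
      k ∈ labelQ' C β p.2 ∧ k ∈ labelQ' C β r.2 := by
    intro k hk
    rw [mem_labelQ'_iff] at hk
    have e := (slackQ'_comb (C := C) (β := β) (1 / 2) (1 / 2) p.2 r.2 k).symm.trans hk
    have := sQ k
    have := tQ k
    rw [mem_labelQ'_iff, mem_labelQ'_iff]
    constructor <;> linarith
  have hU : ∀ k, k ∈ labelP A ((1 / 2 : ℝ) • p + (1 / 2 : ℝ) • r).1 ∨
      k ∈ labelQ' C β ((1 / 2 : ℝ) • p + (1 / 2 : ℝ) • r).2 := fun k => by
    rw [← Finset.mem_union, hsN.2]; exact Finset.mem_univ k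
  have h1 : ∀ k ∈ labelP A r.1, k ∈ labelP A ((1 / 2 : ℝ) • p + (1 / 2 : ℝ) • r).1 := fun k hk =>
    (hU k).resolve_right fun h => Finset.disjoint_left.1 hdis hk (hQ k h).2
  have h2 : ∀ k ∈ labelQ' C β r.2, k ∈ labelQ' C β ((1 / 2 : ℝ) • p + (1 / 2 : ℝ) • r).2 :=
    fun k hk => (hU k).resolve_left fun h => Finset.disjoint_left.1 hdis (hP k h).2 hk
  exact ⟨Finset.Subset.antisymm h1 fun k hk => (hP k hk).2, fun k hk => (hP k (h1 k hk)).1,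
    fun k hk => (hQ k (h2 k hk)).1⟩

/-- If the crossing point were a vertex, all points of the edge would have its labels and so equal
it, contradicting dimension one. -/
theorem ne_of_isVertexN {u : Pt m n} (hu : IsVertexN A C β u) : u ≠ ((y, π₁), (x, l, π₂)) := by
  rintro rfl
  have hall : ∀ p ∈ F, p = ((y, π₁), (x, l, π₂)) := fun p hp =>
    eq_of_extreme hu.2 (hF.1 hp).1 (labels_subset_of_mem_edge hG hF hr hl hp).2.1
      (labels_subset_of_mem_edge hG hF hr hl hp).2.2
  have h1 := hF.2.2
  rw [Set.eq_singleton_iff_unique_mem.2 ⟨hr, hall⟩, vectorSpan_singleton, finrank_bot] at h1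
  exact zero_ne_one h1

include hA hB

/-- The midpoint with `p` has a y-part that forms with `x` an equilibrium of the same supports,
hence it is `y`, and so is that of `p`. A row in the support of `x` is tight at both points and
fixes π₁. -/
theorem fst_eq_of_mem_edge [NeZero m] [NeZero n] {p : Pt m n} (hp : p ∈ F) : p.1 = (y, π₁) := by
  have hN := isNash_of_mem_edge hF hr hl
  have hrN := hF.1 hr
  have hpN := hF.1 hp
  obtain ⟨h1, h2, -⟩ := labels_subset_of_mem_edge hG hF hr hl hp
  set s : Pt m n := (1 / 2 : ℝ) • p + (1 / 2 : ℝ) • ((y, π₁), (x, l, π₂)) with hs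
  have hsP : s.1 ∈ P A := by
    refine (comb_mem (C := C) (β := β) (by norm_num) hpN.1 hrN.1 (fun k => ?_) (fun k => ?_)).1
    · have := (mem_P_iff.1 hrN.1.1).1 k
      have := (mem_P_iff.1 hpN.1.1).1 k
      positivity
    · have := (mem_Q'_iff.1 hrN.1.2).1 k
      have := (mem_Q'_iff.1 hpN.1.2).1 k
      positivity
  have hsN : IsNash A (C + Matrix.vecMulVec α β) x s.1.1 := by
    refine isNash_of_labels (π₁ := s.1.2) hsP (mem_Q_of_hyper hl hrN.1.2) ?_
    rw [labelQ_of_hyper hl]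
    exact (congrArg (· ∪ labelQ' C β (x, l, π₂)) h1.symm).trans hrN.2
  have hsupp : supp s.1.1 = supp y := by
    ext j
    rw [← not_iff_not, notMem_supp hsP.2.1, notMem_supp hrN.1.1.2.1]
    rw [← inr_mem_labelP (A := A) (v := s.1), ← h1, inr_mem_labelP]
  have hy : s.1.1 = y := (IsNash.eq_of_supp_eq hG hA hB hsN hN rfl hsupp).2
  have hpy : p.1.1 = y := by
    have e : (1 / 2 : ℝ) • p.1.1 + (1 / 2 : ℝ) • y = y := hy
    ext j
    have := congrFun e j
    simp only [Pi.add_apply, Pi.smul_apply, smul_eq_mul] at this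
    linarith
  obtain ⟨i, hi⟩ := supp_nonempty hN.1
  have hiP : Sum.inl i ∈ labelP A (y, π₁) := by
    have : Sum.inl i ∈ labelP A (y, π₁) ∪ labelQ' C β (x, l, π₂) := hrN.2 ▸ Finset.mem_univ _
    rw [Finset.mem_union, inl_mem_labelQ'] at this
    exact this.resolve_right (mem_supp.1 hi).ne'
  have hip := h2 hiP
  rw [inl_mem_labelP] at hiP hip
  rw [hpy] at hip
  exact Prod.ext hpy (hip.symm.trans hiP)

include hQ'

/-- The index of an equilibrium on an edge in terms of an end point of the edge. -/
theorem index_eq_vertexSign_mul_sign [NeZero m] [NeZero n] {u : Pt m n} (huF : u ∈ F)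
    (hu : IsVertexN A C β u) :
    index A (C + Matrix.vecMulVec α β) x y = ((vertexSign A C β u : SignType) : ℤ) *
      ((SignType.sign (hyper α u) : SignType) : ℤ) := by
  have hN := isNash_of_mem_edge hF hr hl
  have hrN := hF.1 hr
  have hdis := disjoint_labels_of_mem_edge hG hF hr hl
  have hu1 := fst_eq_of_mem_edge hG hA hB hF hr hl huF
  obtain ⟨-, hPsub, hQsub⟩ := labels_subset_of_mem_edge hG hF hr hl huF
  have hrU : ∀ k, k ∈ labelP A (y, π₁) ∨ k ∈ labelQ' C β (x, l, π₂) := fun k => by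
    rw [← Finset.mem_union, hrN.2]; exact Finset.mem_univ k
  have hcompl : ∀ k, k ∈ labelQ' C β (x, l, π₂) ↔ k ∉ labelP A (y, π₁) := fun k =>
    ⟨fun h h' => Finset.disjoint_left.1 hdis h' h, fun h => (hrU k).resolve_left h⟩
  have hrP : labelP A (y, π₁) = (supp x).disjSum (supp y)ᶜ := by
    ext (i | j)
    · rw [Finset.inl_mem_disjSum, ← not_iff_not, ← hcompl, inl_mem_labelQ', notMem_supp hN.1.1]
    · rw [Finset.inr_mem_disjSum, inr_mem_labelP, Finset.mem_compl, notMem_supp hN.2.1.1]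
  have hrQ : labelQ' C β (x, l, π₂) = (supp x)ᶜ.disjSum (supp y) := by
    ext (i | j)
    · rw [hcompl, hrP]; simp
    · rw [hcompl, hrP]; simp
  -- Without a new label the extreme point `u` would coincide with the crossing point. Since the
  -- latter has m labels in Q' and `u` at most m + 1, the new label is unique.
  obtain ⟨k, hkQ, hkr⟩ : ∃ k ∈ labelQ' C β u.2, k ∉ labelQ' C β (x, l, π₂) := by
    by_contra! h
    refine ne_of_isVertexN hG hF hr hl hu (eq_of_extreme hu.2 hrN.1 ?_ h).symm
    rw [hu1]
  have hcardQ : (labelQ' C β (x, l, π₂)).card = m := by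
    have hle := Finset.card_le_univ (supp x)
    rw [Fintype.card_fin] at hle
    rw [hrQ, Finset.card_disjSum, Finset.card_compl, Fintype.card_fin, ← hN.card_supp_eq hG]
    omega
  have huQ : labelQ' C β u.2 = insert k ((supp x)ᶜ.disjSum (supp y)) := by
    rw [← hrQ]
    symm
    refine Finset.eq_of_subset_of_card_le (Finset.insert_subset hkQ hQsub) ?_
    rw [Finset.card_insert_of_notMem hkr, hcardQ]
    exact hQ' _ (hF.1 huF).1.2
  have hkP : k ∈ labelP A (y, π₁) := by_contra fun h => hkr ((hcompl k).2 h)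
  have hxJ : ∀ j ∈ supp y, (x ᵥ* (C + Matrix.vecMulVec α β)) j = π₂ := by
    intro j hj
    have : Sum.inr j ∈ labelQ' C β (x, l, π₂) := by rw [hrQ]; simpa using hj
    rw [← labelQ_of_hyper hl, inr_mem_labelQ] at this
    exact this
  have hQm := mem_Q_of_hyper hl hrN.1.2
  have key := det_vertex_mul_hyper (α := α) hu.1 (hN.card_supp_eq hG)
    (fun i hi => (notMem_supp hN.1.1).1 hi) hxJ (by rw [hu1]; exact hrP) huQ (by rw [hu1]; exact hkP)
  have hπ₁ : 0 < u.1.2 := by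
    rw [hu1]
    obtain ⟨i, _⟩ := supp_nonempty hN.1
    exact (payoff_pos hA hN.2.1 i).trans_le (hrN.1.1.1 i)
  have hπ₂ : 0 < π₂ := by
    obtain ⟨j, _⟩ := supp_nonempty hN.2.1
    have := payoff_pos (M := (C + Matrix.vecMulVec α β)ᵀ) (fun i j => hB j i) hN.1 j
    rw [Matrix.mulVec_transpose] at this
    exact this.trans_le (hQm.2.1 j)
  -- The label `k` is not tight in Q' at the crossing point, so its inequality is strict there.
  have hneg : Sum.elim (fun i => -x i) (fun j => (x ᵥ* (C + Matrix.vecMulVec α β)) j - π₂) k < 0 := by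
    rcases k with i | j
    · rw [hrP, Finset.inl_mem_disjSum, mem_supp] at hkP
      simpa using hkP
    · rw [← labelQ_of_hyper hl, inr_mem_labelQ] at hkr
      have := lt_of_le_of_ne (hQm.2.1 j) hkr
      simpa using this
  have hs := congrArg (fun t : ℝ => ((SignType.sign t : SignType) : ℤ)) key
  simp only [sign_mul, sign_pos hπ₁, sign_pos hπ₂, sign_neg hneg, one_mul] at hs
  rw [vertexSign, index, sign_mul (detEv A C β u), ← SignType.coe_mul, hs]
  rcases Nat.even_or_odd (supp x).card with h | h
  · rw [h.neg_one_pow, h.add_one.neg_one_pow, sign_one]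
    simp [sign_mul]
  · rw [h.neg_one_pow, h.add_one.neg_one_pow, sign_neg (by norm_num : (-1 : ℝ) < 0)]
    simp [sign_mul]

theorem index_eq_one_of_crossesUp [NeZero m] [NeZero n] (h : CrossesUp A C β α F) :
    index A (C + Matrix.vecMulVec α β) x y = 1 := by
  obtain ⟨p, q, ⟨-, -, -, u, huF, hu, hor⟩, hp, hq⟩ := h
  have hu1 := fst_eq_of_mem_edge hG hA hB hF hr hl huF
  have hne := ne_of_isVertexN hG hF hr hl hu
  -- v is constant on the edge; if w were too, `u` would be the crossing point. This leaves one
  -- alternative of the orientation rule.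
  have hno : ¬ ∀ p ∈ F, p.2 = u.2 := fun h => hne (Prod.ext hu1 (h _ hr).symm)
  rw [index_eq_vertexSign_mul_sign hQ' hG hA hB hF hr hl huF hu]
  rcases hor with ⟨h1, a, b, ha, hb, -, rfl⟩ | ⟨h1, a, b, ha, hb, -, rfl⟩
  · rw [hyper_comb] at hp
    have hs := (h1.resolve_left fun h => hno h.1).2
    have : hyper α u < 0 := by
      by_contra! h
      have := mul_nonneg ha h
      have := mul_nonneg hb hq.le
      linarith
    rw [hs, sign_neg this]
    rfl
  · rw [hyper_comb] at hq
    have hs := (h1.resolve_left fun h => hno h.1).2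
    have : 0 < hyper α u := by
      by_contra! h
      have := mul_nonneg ha (neg_nonneg.2 h)
      have := mul_nonneg hb (neg_nonneg.2 hp.le)
      linarith
    rw [hs, sign_pos this]
    rfl

theorem crossesUp_of_index_eq_one [NeZero m] [NeZero n] {u : Pt m n} (huF : u ∈ F)
    (hu : IsVertexN A C β u) (h : index A (C + Matrix.vecMulVec α β) x y = 1) :
    CrossesUp A C β α F := by
  have hrN := hF.1 hr
  have huN := hF.1 huF
  have hfst : ∀ p ∈ F, p.1 = u.1 := fun p hp =>
    (fst_eq_of_mem_edge hG hA hB hF hr hl hp).trans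
      (fst_eq_of_mem_edge hG hA hB hF hr hl huF).symm
  obtain ⟨-, hPsub, hQsub⟩ := labels_subset_of_mem_edge hG hF hr hl huF
  have hidx := index_eq_vertexSign_mul_sign hQ' hG hA hB hF hr hl huF hu
  rw [h] at hidx
  have hr0 : hyper α ((y, π₁), (x, l, π₂)) = 0 := by simp [hyper, hl]
  -- Prolonging the edge from `u` slightly beyond the crossing point yields a point on the other
  -- side of H, and with `u` a witness for the direction.
  obtain ⟨ε, hε, hq⟩ := exists_extend hrN.1 huN.1 hPsub hQsub
  have hqF := IsExposed.mem_of_comb hF.2.1 hr huF (by ring) hq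
  have hqh : hyper α ((1 + ε) • ((y, π₁), (x, l, π₂)) + (-ε) • u) = -ε * hyper α u := by
    rw [hyper_comb, hr0, mul_zero, zero_add]
  rcases lt_trichotomy (hyper α u) 0 with h0 | h0 | h0
  · have hs : vertexSign A C β u = -1 := by
      rw [sign_neg h0] at hidx
      revert hidx
      generalize vertexSign A C β u = s
      revert s; decide
    have hpos : 0 < hyper α ((1 + ε) • ((y, π₁), (x, l, π₂)) + (-ε) • u) := by
      rw [hqh]; nlinarith
    refine ⟨u, _, ⟨huF, hqF, ?_, u, huF, hu, Or.inl ⟨Or.inr ⟨hfst, hs⟩, left_mem_segment ℝ _ _⟩⟩,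
      h0, hpos⟩
    intro e
    rw [← e] at hpos
    linarith
  · rw [h0, sign_zero] at hidx
    simp at hidx
  · have hs : vertexSign A C β u = 1 := by
      rw [sign_pos h0] at hidx
      revert hidx
      generalize vertexSign A C β u = s
      revert s; decide
    have hneg : hyper α ((1 + ε) • ((y, π₁), (x, l, π₂)) + (-ε) • u) < 0 := by
      rw [hqh]; nlinarith
    refine ⟨_, u, ⟨hqF, huF, ?_, u, huF, hu, Or.inr ⟨Or.inr ⟨hfst, hs⟩, left_mem_segment ℝ _ _⟩⟩,
      hneg, h0⟩
    intro e
    rw [e] at hneg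
    linarith

end Crossing

end Edge

end BimatrixGame

theorem mainTheorem8 (m n : ℕ) (hm : 0 < m) (hn : 0 < n) :
    (∀ (A C : Matrix (Fin m) (Fin n) ℝ) (β : Fin n → ℝ) (α : Fin m → ℝ),
      BimatrixGame.NondegP A → BimatrixGame.NondegQ' C β →
      BimatrixGame.Nondegenerate A (C + Matrix.vecMulVec α β) →
      (∀ i j, 0 < A i j) → (∀ i j, 0 < (C + Matrix.vecMulVec α β) i j) →
      ∀ F : Set (BimatrixGame.Pt m n), BimatrixGame.IsEdgeN A C β F →
        (∃ u ∈ F, BimatrixGame.IsVertexN A C β u) →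
        ∀ (y : Fin n → ℝ) (π₁ : ℝ) (x : Fin m → ℝ) (l π₂ : ℝ),
          ((y, π₁), (x, l, π₂)) ∈ F → l = ∑ i, α i * x i →
          BimatrixGame.IsNash A (C + Matrix.vecMulVec α β) x y ∧
          (BimatrixGame.CrossesUp A C β α F →
            BimatrixGame.index A (C + Matrix.vecMulVec α β) x y = 1) ∧
          (¬ BimatrixGame.CrossesUp A C β α F →
            BimatrixGame.index A (C + Matrix.vecMulVec α β) x y = -1)) ∧
    (∀ A B : Matrix (Fin m) (Fin n) ℝ,
      BimatrixGame.Nondegenerate A B → (∀ i j, 0 < A i j) → (∀ i j, 0 < B i j) →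
      {z : (Fin m → ℝ) × (Fin n → ℝ) | BimatrixGame.IsNash A B z.1 z.2}.Finite ∧
      (∀ x y, BimatrixGame.IsNash A B x y →
        BimatrixGame.index A B x y = 1 ∨ BimatrixGame.index A B x y = -1) ∧
      {z : (Fin m → ℝ) × (Fin n → ℝ) | BimatrixGame.IsNash A B z.1 z.2 ∧
          BimatrixGame.index A B z.1 z.2 = 1}.ncard =
        {z : (Fin m → ℝ) × (Fin n → ℝ) | BimatrixGame.IsNash A B z.1 z.2 ∧
          BimatrixGame.index A B z.1 z.2 = -1}.ncard + 1) := by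
  have : NeZero m := ⟨hm.ne'⟩
  have : NeZero n := ⟨hn.ne'⟩
  refine ⟨fun A C β α _ hQ' hG hA hB F hF ⟨u, huF, hu⟩ y π₁ x l π₂ hr hl => ?_,
    fun A B hAB hA hB => ⟨BimatrixGame.finite_isNash hAB hA hB,
      fun x y h => h.index_eq_one_or hAB hA hB, BimatrixGame.index_theorem hAB hA hB⟩⟩
  have hN := BimatrixGame.isNash_of_mem_edge hF hr hl
  refine ⟨hN, BimatrixGame.index_eq_one_of_crossesUp hQ' hG hA hB hF hr hl, fun h => ?_⟩
  -- The index is ±1, and +1 would force an upward crossing.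
  exact (hN.index_eq_one_or hG hA hB).resolve_left fun h1 =>
    h (BimatrixGame.crossesUp_of_index_eq_one hQ' hG hA hB hF hr hl huF hu h1)
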